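/- **Theorem (Fourier coefficients generation).** There are absolute constants $C>0$ and $k,Q\in\mathbb N$ such that the following holds. Let $n\ge 1$ be an integer, $0<\epsilon\le 1$, $M>0$ and $M'\ge 0$. Then there are positive integers $n_{\mathrm{Abs}},n_{\mathrm{Arg}}\le C/\epsilon$ and $$ n_{\mathrm{in}}\le C\left(\frac{M'\,n\ln(1+n)}{M\epsilon}+\frac{n^2\ln(1+n)}{\epsilon}\right), $$ and a quantum circuit with two oracle slots, consisting of at most $Q$ queries to $O_{\mathrm{Abs}}$ or $O_{\mathrm{Abs}}^\dagger$, at most $Q$ queries to $O_{\mathrm{Arg}}$ or $O_{\mathrm{Arg}}^\dagger$, and at most $$ C\,\ln^k\!\left(1+\frac{M'n}{M\epsilon}+\frac{n^2}{\epsilon}\right) $$ arbitrary two-qubit gates, with the following property. Let $g:\mathbb R\to\mathbb C$ be any $2\pi$-periodic differentiable function with $\|g\|_{\max}=\sup_{\omega\in[-\pi,\pi]}|g(\omega)|=M$ and $\|g'\|_{\max}=\sup_{\omega\in[-\pi,\pi]}|g'(\omega)|=M'$, and let $\xi_j=\frac1{2\pi}\int_{-\pi}^{\pi}g(\omega)e^{ij\omega}\,d\omega$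 be its Fourier coefficients, in the convention $g(\omega)=\sum_{j\in\mathbb Z}\xi_je^{-ij\omega}$. Let $O_{\mathrm{Abs}}$ and $O_{\mathrm{Arg}}$ be any unitaries such that, for all $m\in\{0,\dots,2n-1\}$ and $s\in\{0,\dots,n_{\mathrm{in}}-1\}$, with $x_{m,s}=\frac{m\pi}{n}+\pi-\frac{2\pi}{n_{\mathrm{in}}}s$, $$ O_{\mathrm{Abs}}|m,s,0\rangle=\left|m,s,\left\lfloor n_{\mathrm{Abs}}\frac{|g(x_{m,s})|}{M}\right\rfloor\right\rangle,\qquad O_{\mathrm{Arg}}|m,s,0\rangle=\left|m,s,\left\lfloor n_{\mathrm{Arg}}\frac{\mathrm{Arg}(g(x_{m,s}))}{2\pi}\right\rfloor\right\rangle, $$ where $\mathrm{Arg}\in[0,2\pi)$, with $\mathrm{Arg}(0)=0$; the registers hold $2n$, $n_{\mathrm{in}}$, and $n_{\mathrm{Abs}}+1$ (respectively $n_{\mathrm{Arg}}$) values, and a register of $d$ values consists of $\lceil\log_2 d\rceil$ qubits holding the value in binary. Then the unitary $U$ performed by the circuit with these oracles satisfies $$ \left\|\,(\langle 0|\otimes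 I)\,U\,(|0\rangle\otimes I)-\frac{\sum_{j=0}^{n-1}\xi_jL_n^j}{\left(\frac{\pi}{2}+\ln n\right)\|g\|_{\max}}\right\|\le\epsilon $$ in the spectral norm. Here $L_n=\sum_{k=0}^{n-2}|k+1\rangle\langle k|$ is the $n\times n$ lower shift matrix, so that $\sum_{j<n}\xi_jL_n^j$ is the lower-triangular Toeplitz matrix of the first $n$ Fourier coefficients, and $|0\rangle\otimes I$ is the isometry that embeds $\mathbb C^n$ by $|k\rangle\mapsto|0\cdots0\rangle|k\rangle$, $0\le k<n$, with $k$ in binary on $\lceil\log_2 n\rceil$ system qubits and all ancilla qubits in the state $|0\rangle$. In other words, the circuit block encodes the normalized operator to accuracy $\epsilon$. -/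

import Mathlib

namespace FourierGen

open scoped Matrix

/-! ### Qubits, gates with oracle queries, and circuits -/

/-- Computational basis labels of the register formed by the qubits in `ι`. -/
abbrev Bits (ι : Type) : Type := ι → Bool

/-- Unitary operators on the register formed by the qubits in `ι`. -/
abbrev QUnitary (ι : Type) [Fintype ι] [DecidableEq ι] : Type :=
  Matrix.unitaryGroup (Bits ι) ℂ

/-- The binary expansion of `m` (least significant bit first) on `w` qubits. -/
def encode (w m : ℕ) : Bits (Fin w) := fun i => m.testBit i

/-- The number of qubits of a register that holds `d` values `0, …, d - 1`. -/
def width (d : ℕ) : ℕ := Nat.clog 2 d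

open Classical in
/-- The operator `U` applied to the qubits `w` of a larger register, that is, `U ⊗ I` with the
identity on all qubits outside the range of `w`. -/
noncomputable def applyOn {ι κ : Type} (w : ι ↪ κ) (U : Matrix (Bits ι) (Bits ι) ℂ) :
    Matrix (Bits κ) (Bits κ) ℂ :=
  Matrix.of fun x y =>
    if ∀ i, i ∉ Set.range w → x i = y i then U (fun j => x (w j)) (fun j => y (w j)) else 0

/-- One step of a circuit on `N` qubits with two oracles, which act on `p` and on `q` qubits: an
arbitrary two-qubit gate on two distinct qubits, or one query to an oracle (`false`) or
to its inverse (`true`) on distinct qubits. -/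
inductive Gate (p q N : ℕ) : Type
  | two (w : Fin 2 ↪ Fin N) (U : QUnitary (Fin 2)) : Gate p q N
  | queryAbs (inv : Bool) (w : Fin p ↪ Fin N) : Gate p q N
  | queryArg (inv : Bool) (w : Fin q ↪ Fin N) : Gate p q N

/-- The operator performed by a gate, given the two oracles. -/
noncomputable def Gate.toMatrix {p q N : ℕ} (OAbs : QUnitary (Fin p)) (OArg : QUnitary (Fin q)) :
    Gate p q N → Matrix (Bits (Fin N)) (Bits (Fin N)) ℂ
  | .two w U => applyOn w U.1
  | .queryAbs inv w => applyOn w (if inv then (OAbs.1)ᴴ else OAbs.1)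
  | .queryArg inv w => applyOn w (if inv then (OArg.1)ᴴ else OArg.1)

/-- `1` for a two-qubit gate, `0` for a query. -/
def Gate.twoQubitCost {p q N : ℕ} : Gate p q N → ℕ
  | .two _ _ => 1
  | .queryAbs _ _ => 0
  | .queryArg _ _ => 0

/-- `1` for a query to the first oracle or its inverse, `0` otherwise. -/
def Gate.absCost {p q N : ℕ} : Gate p q N → ℕ
  | .two _ _ => 0
  | .queryAbs _ _ => 1
  | .queryArg _ _ => 0

/-- `1` for a query to the second oracle or its inverse, `0` otherwise. -/
def Gate.argCost {p q N : ℕ} : Gate p q N → ℕ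
  | .two _ _ => 0
  | .queryAbs _ _ => 0
  | .queryArg _ _ => 1

/-- A circuit is a finite sequence of gates and queries; the head of the list acts first. -/
abbrev Circuit (p q N : ℕ) : Type := List (Gate p q N)

/-- The operator performed by a circuit, given the two oracles. -/
noncomputable def Circuit.toMatrix {p q N : ℕ} (OAbs : QUnitary (Fin p))
    (OArg : QUnitary (Fin q)) : Circuit p q N → Matrix (Bits (Fin N)) (Bits (Fin N)) ℂ
  | [] => 1
  | g :: c => Circuit.toMatrix OAbs OArg c * g.toMatrix OAbs OArg

/-- Number of two-qubit gates of a circuit. -/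
def Circuit.twoQubitGates {p q N : ℕ} (c : Circuit p q N) : ℕ := (c.map Gate.twoQubitCost).sum

/-- Number of queries of a circuit to the first oracle and its inverse. -/
def Circuit.absQueries {p q N : ℕ} (c : Circuit p q N) : ℕ := (c.map Gate.absCost).sum

/-- Number of queries of a circuit to the second oracle and its inverse. -/
def Circuit.argQueries {p q N : ℕ} (c : Circuit p q N) : ℕ := (c.map Gate.argCost).sum

/-! ### Block encoding -/

/-- `A` is block encoded to accuracy `ε` by the isometries `G₀`, `G₁` and the unitary `U`: the
operator `G₁† U G₀` is within spectral-norm distance `ε` of `A`. -/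
def IsBlockEncoding {𝒢 ℋ : Type} [Fintype 𝒢] [DecidableEq 𝒢] [Fintype ℋ] [DecidableEq ℋ]
    (G₀ G₁ : Matrix ℋ 𝒢 ℂ) (U : Matrix ℋ ℋ ℂ) (A : Matrix 𝒢 𝒢 ℂ) (ε : ℝ) : Prop :=
  G₀ᴴ * G₀ = 1 ∧ G₁ᴴ * G₁ = 1 ∧ U ∈ Matrix.unitaryGroup ℋ ℂ ∧
    ‖Matrix.toEuclideanCLM (n := 𝒢) (𝕜 := ℂ) (G₁ᴴ * U * G₀ - A)‖ ≤ ε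

/-- The isometry `|k⟩ ↦ |k⟩|0…0⟩` (`k = 0, …, n - 1`) from the `n`-dimensional system space into
the register formed by the system qubits, which hold `k` in binary, and `a` ancilla qubits. -/
def ancillaZero (n a : ℕ) : Matrix (Bits (Fin (width n + a))) (Fin n) ℂ :=
  Matrix.of fun x k =>
    if x = Fin.append (encode (width n) k) (fun _ : Fin a => false) then 1 else 0

/-! ### Fourier coefficients and the target operator -/

/-- The `j`-th Fourier coefficient `ξ_j`, in the convention `g(ω) = ∑ ξ_j e^{-ijω}`. -/
noncomputable def fourierCoefficient (g : ℝ → ℂ) (j : ℤ) : ℂ :=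
  (1 / (2 * Real.pi) : ℂ) *
    ∫ ω in (-Real.pi)..Real.pi, g ω * Complex.exp (Complex.I * j * ω)

/-- The `n × n` lower shift matrix, with `1` on the first lower diagonal and `0` elsewhere. -/
def lowerShift (n : ℕ) : Matrix (Fin n) (Fin n) ℂ :=
  Matrix.of fun k l => if (k : ℕ) = (l : ℕ) + 1 then 1 else 0

/-- The lower-triangular Toeplitz matrix `∑_{j < n} ξ_j L^j`. -/
noncomputable def fourierToeplitz (n : ℕ) (g : ℝ → ℂ) : Matrix (Fin n) (Fin n) ℂ :=
  ∑ j ∈ Finset.range n, fourierCoefficient g j • lowerShift n ^ j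

/-- `M` is the max-norm of `h` on `[-π, π]`; in particular `h` is bounded there. -/
def IsMaxNorm (h : ℝ → ℂ) (M : ℝ) : Prop :=
  IsLUB ((fun ω => ‖h ω‖) '' Set.Icc (-Real.pi) Real.pi) M

/-! ### The oracles -/

/-- The argument of a complex number in `[0, 2π)`. -/
noncomputable def arg2pi (z : ℂ) : ℝ := toIcoMod Real.two_pi_pos 0 (Complex.arg z)

/-- The sample point `mπ/n + π - (2π/n_in) s`. -/
noncomputable def samplePoint (n nIn m s : ℕ) : ℝ :=
  m * Real.pi / n + Real.pi - 2 * Real.pi / nIn * s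

/-- The number of qubits on which an oracle acts: a `2n`-value register, an `n_in`-value register
and a `d`-value output register. -/
def oracleWidth (n nIn d : ℕ) : ℕ := width (2 * n) + width nIn + width d

/-- The basis state label of `|m, s, v⟩`. -/
def oracleLabel (n nIn d m s v : ℕ) : Bits (Fin (oracleWidth n nIn d)) :=
  Fin.append (Fin.append (encode (width (2 * n)) m) (encode (width nIn) s)) (encode (width d) v)

/-- The unitary `O` satisfies `O|m, s, 0⟩ = |m, s, f(m, s)⟩` for all `m < 2n` and `s < n_in`. Its
action on the remaining basis states is not specified. -/
def IsOracle (n nIn d : ℕ) (f : ℕ → ℕ → ℕ) (O : QUnitary (Fin (oracleWidth n nIn d))) : Prop :=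
  ∀ m < 2 * n, ∀ s < nIn,
    O.1 *ᵥ Pi.single (oracleLabel n nIn d m s 0) 1 = Pi.single (oracleLabel n nIn d m s (f m s)) 1

/-- `O_Abs|m, s, 0⟩ = |m, s, ⌊n_Abs |g(x)| / M⌋⟩` at the sample point `x`, where `M` is the
max-norm of `g`; the output register holds `n_Abs + 1` values. -/
def IsAbsOracle (g : ℝ → ℂ) (M : ℝ) (n nIn nAbs : ℕ)
    (O : QUnitary (Fin (oracleWidth n nIn (nAbs + 1)))) : Prop :=
  IsOracle n nIn (nAbs + 1) (fun m s => ⌊nAbs * (‖g (samplePoint n nIn m s)‖ / M)⌋₊) O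

/-- `O_Arg|m, s, 0⟩ = |m, s, ⌊n_Arg Arg(g(x)) / 2π⌋⟩` at the sample point `x`; the output register
holds `n_Arg` values. -/
def IsArgOracle (g : ℝ → ℂ) (n nIn nArg : ℕ)
    (O : QUnitary (Fin (oracleWidth n nIn nArg))) : Prop :=
  IsOracle n nIn nArg
    (fun m s => ⌊nArg * (arg2pi (g (samplePoint n nIn m s)) / (2 * Real.pi))⌋₊) O

end FourierGen

namespace FourierGen

open scoped Matrix

/-! ### Operators on part of a register -/

section ApplyOn

/-! For `l ≤ k` the target entry is proportional to `ξ_{k-l}`, which a Riemann sum at `x_s = π -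
2πs/n_in` approximates by the average over `s` of `g(x_s) e^{ikx_s} e^{-ilx_s}`. This is an inner
product of two discrete Fourier states with multiplication by `g(x_s)` in between. A circuit
preparing `ψ_l` followed by the inverse of a circuit preparing `φ_k` has the block entries `⟨φ_k,
ψ_l⟩` (`Prepares.block`), so it suffices to prepare two families of states, with one query to each
oracle per preparation. The queries use `m = 0`, where the sample points are exactly the `x_s`.

Three ingredients enter the inner product. The Fourier transform supplies the phases
(`prepares_fourier`, `prod_fourierAmp`).

Second, the entries with `l > k` are removed by a Schur multiplier of logarithmic cost
(`sum_levelAmp`). Let `s_j = ±1` record whether `l mod 2^j ≤ k mod 2^j`. Then `s_{j+1} = [k_j = l_j]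
s_j + (k_j - l_j)` for the bits `k_j`, `l_j`, with `[k_j = l_j] = (1 + (-1)^{k_j + l_j})/2` and `k_j
- l_j = ((-1)^{l_j} - (-1)^{k_j})/2`. Thus `s_w` is a combination, of total weight `w + 1`, of signs
that factor into a part depending on `k` and a part depending on `l`, and `(1 + s_w)/2` has weight
`(w + 2)/2`. For `w = ⌈log₂ n⌉` this weight is at most `π/2 + ln n` (`width_add_two_div_two_le`),
and one rotation adjusts the normalization to that value.

Third, the modulus written by the oracle becomes an amplitude by averaging signs of its bits
(`sum_thresholdAmp`), and the argument becomes a phase.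

The rounding error is a diagonal operator between two isometries, so it costs no factor `n`
(`norm_toEuclideanCLM_le_of_orthonormal`). The quadrature error is bounded entrywise
(`norm_fourierCoefficient_sub_le`), at the price of a factor `n` that `n_in` absorbs. -/

theorem extend_comp_embedding {ι κ : Type} (w : ι ↪ κ) (b : Bits ι) (x : Bits κ) :
    (fun j => Function.extend w b x (w j)) = b :=
  funext fun j => w.injective.extend_apply b x j

theorem applyOn_conjTranspose {ι κ : Type} (w : ι ↪ κ) (U : Matrix (Bits ι) (Bits ι) ℂ) :
    (applyOn w U)ᴴ = applyOn w Uᴴ := by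
  ext x y
  simp only [applyOn, Matrix.conjTranspose_apply, Matrix.of_apply]
  by_cases h : ∀ i, i ∉ Set.range w → x i = y i
  · rw [if_pos h, if_pos fun i hi => (h i hi).symm]
  · rw [if_neg h, if_neg fun h' => h fun i hi => (h' i hi).symm, star_zero]

variable {ι κ : Type} [Fintype ι] [DecidableEq ι] [Fintype κ] [DecidableEq κ]

/-- `Function.extend w b x` is `x` with the qubits in the range of `w` overwritten by `b`; only such
columns meet the row `x`. -/
theorem applyOn_mulVec (w : ι ↪ κ) (U : Matrix (Bits ι) (Bits ι) ℂ) (ψ : Bits κ → ℂ)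
    (x : Bits κ) :
    (applyOn w U *ᵥ ψ) x = ∑ b, U (fun j => x (w j)) b * ψ (Function.extend w b x) := by
  symm
  simp only [Matrix.mulVec, dotProduct, applyOn, Matrix.of_apply]
  refine Finset.sum_of_injOn (fun b => Function.extend w b x) ?_ (by simp) ?_ ?_
  · intro b _ b' _ h
    have := congrArg (fun z : Bits κ => fun j => z (w j)) h
    simpa only [extend_comp_embedding] using this
  · intro y _ hy
    rw [if_neg, zero_mul]
    intro h
    refine hy ⟨fun j => y (w j), by simp, ?_⟩
    funext i
    by_cases hi : i ∈ Set.range w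
    · obtain ⟨j, rfl⟩ := hi
      exact w.injective.extend_apply _ _ j
    · rw [← h i hi]
      exact Function.extend_apply' _ _ _ hi
  · intro b _
    rw [if_pos, extend_comp_embedding]
    intro i hi
    exact (Function.extend_apply' _ _ _ hi).symm

theorem applyOn_mul (w : ι ↪ κ) (U V : Matrix (Bits ι) (Bits ι) ℂ) :
    applyOn w (U * V) = applyOn w U * applyOn w V := by
  refine Matrix.ext_of_mulVec_single fun y => funext fun x => ?_
  rw [← Matrix.mulVec_mulVec]
  generalize (Pi.single y 1 : Bits κ → ℂ) = ψ
  have hext : ∀ b c : Bits ι, Function.extend w b (Function.extend w c x) =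
      Function.extend w b x := by
    intro b c
    funext i
    by_cases hi : ∃ j, w j = i
    · obtain ⟨j, rfl⟩ := hi
      simp [w.injective.extend_apply]
    · simp [Function.extend_apply' _ _ _ hi]
  simp only [applyOn_mulVec, extend_comp_embedding, hext, Matrix.mul_apply, Finset.sum_mul,
    Finset.mul_sum]
  rw [Finset.sum_comm]
  simp only [mul_assoc]

theorem applyOn_one (w : ι ↪ κ) : applyOn w (1 : Matrix (Bits ι) (Bits ι) ℂ) = 1 := by
  refine Matrix.ext_of_mulVec_single fun y => funext fun x => ?_
  rw [applyOn_mulVec, Matrix.one_mulVec, Finset.sum_eq_single (fun j => x (w j))]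
  · rw [Matrix.one_apply_eq, one_mul]
    congr 1
    funext i
    by_cases hi : ∃ j, w j = i
    · obtain ⟨j, rfl⟩ := hi
      exact w.injective.extend_apply _ _ j
    · exact Function.extend_apply' _ _ _ hi
  · intro b _ hb
    rw [Matrix.one_apply_ne hb.symm, zero_mul]
  · simp

theorem applyOn_mem_unitaryGroup (w : ι ↪ κ) (U : QUnitary ι) :
    applyOn w U.1 ∈ Matrix.unitaryGroup (Bits κ) ℂ := by
  rw [Matrix.mem_unitaryGroup_iff', Matrix.star_eq_conjTranspose, applyOn_conjTranspose,
    ← applyOn_mul, ← Matrix.star_eq_conjTranspose, Matrix.mem_unitaryGroup_iff'.1 U.2, applyOn_one]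

end ApplyOn

/-! ### Inverse circuits and unitarity -/

section Adjoint

variable {p q N : ℕ}

/-- The gate that performs the inverse operator. -/
noncomputable def Gate.adjoint : Gate p q N → Gate p q N
  | .two w U => .two w U⁻¹
  | .queryAbs inv w => .queryAbs (!inv) w
  | .queryArg inv w => .queryArg (!inv) w

theorem Gate.adjoint_toMatrix (OA : QUnitary (Fin p)) (OB : QUnitary (Fin q)) (g : Gate p q N) :
    g.adjoint.toMatrix OA OB = (g.toMatrix OA OB)ᴴ := by
  rcases g with ⟨w, U⟩ | ⟨_ | _, w⟩ | ⟨_ | _, w⟩ <;>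
    simp [Gate.adjoint, Gate.toMatrix, applyOn_conjTranspose, Matrix.UnitaryGroup.inv_val,
      Matrix.star_eq_conjTranspose]

theorem Gate.toMatrix_mem_unitaryGroup (OA : QUnitary (Fin p)) (OB : QUnitary (Fin q))
    (g : Gate p q N) : g.toMatrix OA OB ∈ Matrix.unitaryGroup (Bits (Fin N)) ℂ := by
  rcases g with ⟨w, U⟩ | ⟨_ | _, w⟩ | ⟨_ | _, w⟩
  · exact applyOn_mem_unitaryGroup w U
  · exact applyOn_mem_unitaryGroup w OA
  · exact applyOn_mem_unitaryGroup w OA⁻¹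
  · exact applyOn_mem_unitaryGroup w OB
  · exact applyOn_mem_unitaryGroup w OB⁻¹

theorem Circuit.toMatrix_append (OA : QUnitary (Fin p)) (OB : QUnitary (Fin q))
    (c d : Circuit p q N) :
    Circuit.toMatrix OA OB (c ++ d) = Circuit.toMatrix OA OB d * Circuit.toMatrix OA OB c := by
  induction c with
  | nil => simp [Circuit.toMatrix]
  | cons g c ih => simp [Circuit.toMatrix, ih, mul_assoc]

theorem Circuit.toMatrix_mem_unitaryGroup (OA : QUnitary (Fin p)) (OB : QUnitary (Fin q))
    (c : Circuit p q N) : Circuit.toMatrix OA OB c ∈ Matrix.unitaryGroup (Bits (Fin N)) ℂ := by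
  induction c with
  | nil => exact one_mem _
  | cons g c ih => exact mul_mem ih (g.toMatrix_mem_unitaryGroup OA OB)

/-- The circuit that performs the inverse operator. -/
noncomputable def Circuit.adjoint (c : Circuit p q N) : Circuit p q N :=
  (c.map Gate.adjoint).reverse

theorem Circuit.adjoint_toMatrix (OA : QUnitary (Fin p)) (OB : QUnitary (Fin q))
    (c : Circuit p q N) :
    Circuit.toMatrix OA OB c.adjoint = (Circuit.toMatrix OA OB c)ᴴ := by
  induction c with
  | nil => simp [Circuit.toMatrix, Circuit.adjoint]
  | cons g c ih =>
    have : Circuit.adjoint (g :: c) = Circuit.adjoint c ++ [g.adjoint] := by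
      simp [Circuit.adjoint]
    rw [this, Circuit.toMatrix_append, ih]
    simp [Circuit.toMatrix, Gate.adjoint_toMatrix]

theorem Circuit.adjoint_costs (c : Circuit p q N) :
    Circuit.twoQubitGates c.adjoint = Circuit.twoQubitGates c ∧
      Circuit.absQueries c.adjoint = Circuit.absQueries c ∧
      Circuit.argQueries c.adjoint = Circuit.argQueries c := by
  have h1 : ∀ g : Gate p q N, g.adjoint.twoQubitCost = g.twoQubitCost := by
    rintro (_ | _ | _) <;> rfl
  have h2 : ∀ g : Gate p q N, g.adjoint.absCost = g.absCost := by rintro (_ | _ | _) <;> rfl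
  have h3 : ∀ g : Gate p q N, g.adjoint.argCost = g.argCost := by rintro (_ | _ | _) <;> rfl
  refine ⟨?_, ?_, ?_⟩ <;>
    simp [Circuit.adjoint, Circuit.twoQubitGates, Circuit.absQueries, Circuit.argQueries,
      List.sum_reverse, Function.comp_def, h1, h2, h3]

end Adjoint

section Pull

variable {κ : Type} [Fintype κ] [DecidableEq κ] {N : ℕ}

/-- A state on the qubits `κ`, read as a state on the qubits `Fin N` labelled by `κ`. -/
def pull (e : κ ≃ Fin N) (ψ : Bits κ → ℂ) : Bits (Fin N) → ℂ := fun y => ψ (fun i => y (e i))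

theorem applyOn_mulVec_pull {ι : Type} [Fintype ι] [DecidableEq ι] (e : κ ≃ Fin N) (w : ι ↪ κ)
    (U : Matrix (Bits ι) (Bits ι) ℂ) (ψ : Bits κ → ℂ) :
    applyOn (w.trans e.toEmbedding) U *ᵥ pull e ψ = pull e (applyOn w U *ᵥ ψ) := by
  funext y
  simp only [pull, applyOn_mulVec]
  refine Finset.sum_congr rfl fun b _ => ?_
  congr 2
  funext i
  by_cases hi : ∃ j, w j = i
  · obtain ⟨j, rfl⟩ := hi
    rw [w.injective.extend_apply]
    exact (w.trans e.toEmbedding).injective.extend_apply _ _ j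
  · rw [Function.extend_apply' _ _ _ hi, Function.extend_apply']
    rintro ⟨j, hj⟩
    exact hi ⟨j, e.injective hj⟩

theorem pull_dotProduct (e : κ ≃ Fin N) (φ ψ : Bits κ → ℂ) :
    star (pull e φ) ⬝ᵥ pull e ψ = star φ ⬝ᵥ ψ := by
  simp only [dotProduct, pull, Pi.star_apply]
  exact Fintype.sum_equiv (Equiv.arrowCongr e.symm (Equiv.refl Bool)) _ _ fun y => rfl

end Pull

/-! ### Preparation of families of states -/

section Prepares

variable {κ : Type} {p q N : ℕ} {Λ : Type}

/-- There is one circuit, with at most `g` two-qubit gates and at most `a` and `b` queries, that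
maps `init l` to `final l` for every `l`, when it is run with the oracles `OA l` and `OB l`. -/
def Prepares (e : κ ≃ Fin N) (OA : Λ → QUnitary (Fin p)) (OB : Λ → QUnitary (Fin q))
    (g a b : ℕ) (init final : Λ → Bits κ → ℂ) : Prop :=
  ∃ c : Circuit p q N, c.twoQubitGates ≤ g ∧ c.absQueries ≤ a ∧ c.argQueries ≤ b ∧
    ∀ l, Circuit.toMatrix (OA l) (OB l) c *ᵥ pull e (init l) = pull e (final l)

variable {e : κ ≃ Fin N} {OA : Λ → QUnitary (Fin p)} {OB : Λ → QUnitary (Fin q)}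

theorem Prepares.refl (init : Λ → Bits κ → ℂ) : Prepares e OA OB 0 0 0 init init :=
  ⟨[], by simp [Circuit.twoQubitGates], by simp [Circuit.absQueries],
    by simp [Circuit.argQueries], fun l => by simp [Circuit.toMatrix]⟩

theorem Prepares.trans {g a b g' a' b' : ℕ} {init mid final : Λ → Bits κ → ℂ}
    (h : Prepares e OA OB g a b init mid) (h' : Prepares e OA OB g' a' b' mid final) :
    Prepares e OA OB (g + g') (a + a') (b + b') init final := by
  obtain ⟨c, hg, ha, hb, hc⟩ := h
  obtain ⟨c', hg', ha', hb', hc'⟩ := h'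
  refine ⟨c ++ c', ?_, ?_, ?_, fun l => ?_⟩
  · simpa [Circuit.twoQubitGates] using add_le_add hg hg'
  · simpa [Circuit.absQueries] using add_le_add ha ha'
  · simpa [Circuit.argQueries] using add_le_add hb hb'
  · rw [Circuit.toMatrix_append, ← Matrix.mulVec_mulVec, hc, hc']

theorem Prepares.congr {g a b : ℕ} {init final init' final' : Λ → Bits κ → ℂ}
    (h : Prepares e OA OB g a b init final) (hi : ∀ l x, init' l x = init l x)
    (hf : ∀ l x, final' l x = final l x) : Prepares e OA OB g a b init' final' := by
  rwa [show init' = init from funext fun l => funext (hi l),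
    show final' = final from funext fun l => funext (hf l)]

theorem Prepares.mono {g a b g' a' b' : ℕ} {init final : Λ → Bits κ → ℂ}
    (h : Prepares e OA OB g a b init final) (hg : g ≤ g') (ha : a ≤ a') (hb : b ≤ b') :
    Prepares e OA OB g' a' b' init final := by
  obtain ⟨c, h1, h2, h3, h4⟩ := h
  exact ⟨c, h1.trans hg, h2.trans ha, h3.trans hb, h4⟩

/-- Linear extension of a preparation of a family of states. -/
theorem Prepares.sum {X : Type} [Fintype X] {g a b : ℕ} {init final : Λ × X → Bits κ → ℂ}
    (h : Prepares e (fun l => OA l.1) (fun l => OB l.1) g a b init final) (ψ : Λ → X → ℂ) :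
    Prepares e OA OB g a b (fun l z => ∑ x, ψ l x * init (l, x) z)
      (fun l z => ∑ x, ψ l x * final (l, x) z) := by
  obtain ⟨c, h1, h2, h3, h4⟩ := h
  refine ⟨c, h1, h2, h3, fun l => ?_⟩
  have key : ∀ η : Λ × X → Bits κ → ℂ, pull e (fun z => ∑ x, ψ l x * η (l, x) z) =
      ∑ x, ψ l x • pull e (η (l, x)) := by
    intro η
    funext y
    simp [pull]
  rw [key, key, Matrix.mulVec_sum]
  refine Finset.sum_congr rfl fun x _ => ?_
  rw [Matrix.mulVec_smul, h4 (l, x)]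

/-- The two-qubit matrix that applies `V b` to qubit `1` if qubit `0` has the value `b`. -/
def muxMatrix (V : Bool → Matrix Bool Bool ℂ) : Matrix (Bits (Fin 2)) (Bits (Fin 2)) ℂ :=
  Matrix.of fun x y => if x 0 = y 0 then V (x 0) (x 1) (y 1) else 0

theorem sum_bits_two {M : Type*} [AddCommMonoid M] (f : Bits (Fin 2) → M) :
    ∑ x, f x = ∑ b, ∑ b', f ![b, b'] := by
  rw [← Fintype.sum_prod_type' fun b b' => f ![b, b']]
  exact Fintype.sum_equiv (finTwoArrowEquiv Bool) _ _ fun x => by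
    congr 1
    funext i
    fin_cases i <;> rfl

theorem muxMatrix_mem_unitaryGroup {V : Bool → Matrix Bool Bool ℂ}
    (hV : ∀ b, V b ∈ Matrix.unitaryGroup Bool ℂ) :
    muxMatrix V ∈ Matrix.unitaryGroup (Bits (Fin 2)) ℂ := by
  rw [Matrix.mem_unitaryGroup_iff']
  ext x y
  have hx : x = ![x 0, x 1] := by funext i; fin_cases i <;> rfl
  have hy : y = ![y 0, y 1] := by funext i; fin_cases i <;> rfl
  have h := fun b => Matrix.mem_unitaryGroup_iff'.1 (hV b)
  have h' := fun b => congrFun (congrFun (h b) (x 1)) (y 1)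
  rw [Matrix.mul_apply, sum_bits_two]
  have hxy : (x = y) ↔ x 0 = y 0 ∧ x 1 = y 1 := by
    constructor
    · rintro rfl; simp
    · rintro ⟨h0, h1⟩; rw [hx, hy, h0, h1]
  simp only [muxMatrix, Matrix.star_apply, Matrix.of_apply, Matrix.cons_val_zero,
    Matrix.cons_val_one, Matrix.one_apply, hxy]
  simp only [Matrix.mul_apply, Matrix.star_apply, Matrix.one_apply] at h'
  rw [Finset.sum_eq_single (x 0)]
  · by_cases h0 : x 0 = y 0
    · simp [h0, ← h' (y 0)]
    · simp [h0]
  · intro b _ hb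
    simp [hb]
  · simp

/-- Two distinct qubits. -/
def pairEmbedding {c t : κ} (h : c ≠ t) : Fin 2 ↪ κ where
  toFun := ![c, t]
  inj' := by
    intro i j hij
    fin_cases i <;> fin_cases j <;> simp_all [eq_comm]

theorem pairEmbedding_zero {c t : κ} (h : c ≠ t) : pairEmbedding h 0 = c := rfl

theorem pairEmbedding_one {c t : κ} (h : c ≠ t) : pairEmbedding h 1 = t := rfl

variable [Fintype κ] [DecidableEq κ]

/-- Unitarity of the circuit, valid when both labels see the same oracles. It later yields
orthonormality of prepared states without computing them. -/
theorem Prepares.dotProduct_eq {g a b : ℕ} {init final : Λ → Bits κ → ℂ}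
    (h : Prepares e OA OB g a b init final) {l l' : Λ} (hA : OA l = OA l') (hB : OB l = OB l') :
    star (final l) ⬝ᵥ final l' = star (init l) ⬝ᵥ init l' := by
  obtain ⟨c, -, -, -, hc⟩ := h
  have hU := Circuit.toMatrix_mem_unitaryGroup (OA l') (OB l') c
  rw [Matrix.mem_unitaryGroup_iff', Matrix.star_eq_conjTranspose] at hU
  rw [← pull_dotProduct e, ← pull_dotProduct e (init l), ← hc, ← hc, hA, hB, Matrix.star_mulVec,
    ← Matrix.dotProduct_mulVec, Matrix.mulVec_mulVec, hU, Matrix.one_mulVec]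

theorem applyOn_muxMatrix {c t : κ} (h : c ≠ t) (V : Bool → Matrix Bool Bool ℂ)
    (ψ : Bits κ → ℂ) (x : Bits κ) :
    (applyOn (pairEmbedding h) (muxMatrix V) *ᵥ ψ) x =
      ∑ b, V (x c) (x t) b * ψ (Function.update x t b) := by
  rw [applyOn_mulVec, sum_bits_two, Finset.sum_eq_single (x c)]
  · refine Finset.sum_congr rfl fun b _ => ?_
    congr 1
    · simp [muxMatrix, pairEmbedding_zero, pairEmbedding_one]
    · congr 1
      funext i
      by_cases hi : ∃ j, pairEmbedding h j = i
      · obtain ⟨j, rfl⟩ := hi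
        rw [(pairEmbedding h).injective.extend_apply]
        fin_cases j
        · exact (Function.update_of_ne h _ _).symm
        · exact (Function.update_self (β := fun _ => Bool) t b x).symm
      · rw [Function.extend_apply' _ _ _ hi, Function.update_of_ne]
        rintro rfl
        exact hi ⟨1, rfl⟩
  · intro b _ hb
    refine Finset.sum_eq_zero fun b' _ => ?_
    simp [muxMatrix, pairEmbedding_zero, hb.symm]
  · simp

/-- With `V` independent of the control this is a one-qubit gate; the control is then any idle
qubit. -/
theorem prepares_mux {c t : κ} (h : c ≠ t) {V : Bool → Matrix Bool Bool ℂ}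
    (hV : ∀ b, V b ∈ Matrix.unitaryGroup Bool ℂ) (init : Λ → Bits κ → ℂ) :
    Prepares e OA OB 1 0 0 init
      (fun l x => ∑ b, V (x c) (x t) b * init l (Function.update x t b)) := by
  refine ⟨[.two ((pairEmbedding h).trans e.toEmbedding)
      ⟨muxMatrix V, muxMatrix_mem_unitaryGroup hV⟩], ?_, ?_, ?_, fun l => ?_⟩
  · simp [Circuit.twoQubitGates, Gate.twoQubitCost]
  · simp [Circuit.absQueries, Gate.absCost]
  · simp [Circuit.argQueries, Gate.argCost]
  · simp only [Circuit.toMatrix, Gate.toMatrix, one_mul, applyOn_mulVec_pull]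
    congr 1
    funext x
    exact applyOn_muxMatrix h V _ x

/-- A product of diagonal two-qubit gates. -/
theorem prepares_phases {ι : Type} (s : Finset ι) (c t : ι → κ) (d : ι → Bool → Bool → ℂ)
    (hct : ∀ i ∈ s, c i ≠ t i) (hd : ∀ i ∈ s, ∀ b b', ‖d i b b'‖ = 1)
    (init : Λ → Bits κ → ℂ) :
    Prepares e OA OB s.card 0 0 init
      (fun l x => (∏ i ∈ s, d i (x (c i)) (x (t i))) * init l x) := by
  classical
  induction s using Finset.induction_on with
  | empty => simpa using Prepares.refl init
  | insert i s his ih =>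
    have ih := ih (fun j hj => hct j (Finset.mem_insert_of_mem hj))
      fun j hj => hd j (Finset.mem_insert_of_mem hj)
    have hV : ∀ b, Matrix.diagonal (d i b) ∈ Matrix.unitaryGroup Bool ℂ := by
      intro b
      rw [Matrix.mem_unitaryGroup_iff', Matrix.star_eq_conjTranspose,
        Matrix.diagonal_conjTranspose, Matrix.diagonal_mul_diagonal, ← Matrix.diagonal_one]
      congr 1
      funext b'
      rw [Pi.star_apply, RCLike.star_def, RCLike.conj_mul, hd i (Finset.mem_insert_self i s)]
      simp
    have h1 := ih.trans (prepares_mux (e := e) (OA := OA) (OB := OB)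
      (hct i (Finset.mem_insert_self i s)) hV _)
    rw [Finset.card_insert_of_notMem his]
    refine h1.congr (fun _ _ => rfl) fun l x => ?_
    rw [Finset.sum_eq_single (x (t i)), Function.update_eq_self, Matrix.diagonal_apply_eq,
      Finset.prod_insert his, mul_assoc]
    · intro b _ hb
      rw [Matrix.diagonal_apply_ne _ hb.symm, zero_mul]
    · simp

/-- Only one column of `U` is used, so an oracle that is specified only on some basis states can be
applied. -/
theorem applyOn_mulVec_single {ι : Type} [Fintype ι] [DecidableEq ι] (w : ι ↪ κ)
    (U : Matrix (Bits ι) (Bits ι) ℂ) {y y' : Bits κ}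
    (hU : U *ᵥ Pi.single (fun j => y (w j)) 1 = Pi.single (fun j => y' (w j)) 1)
    (hy : ∀ i ∉ Set.range w, y i = y' i) :
    applyOn w U *ᵥ Pi.single y 1 = Pi.single y' 1 := by
  rw [Matrix.mulVec_single_one] at hU ⊢
  funext x
  have hx := congrFun hU fun j => x (w j)
  simp only [Matrix.col_apply, applyOn, Matrix.of_apply] at hx ⊢
  rw [hx]
  by_cases h : x = y'
  · subst h
    rw [if_pos fun i hi => (hy i hi).symm, Pi.single_eq_same, Pi.single_eq_same]
  · rw [Pi.single_eq_of_ne h]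
    split_ifs with h'
    · refine Pi.single_eq_of_ne (fun h'' => h (funext fun i => ?_)) _
      by_cases hi : i ∈ Set.range w
      · obtain ⟨j, rfl⟩ := hi
        exact congrFun h'' j
      · rw [h' i hi, hy i hi]
    · rfl

theorem pull_single {κ : Type} [Fintype κ] (e : κ ≃ Fin N) (y : Bits κ) :
    pull e (Pi.single y 1) = Pi.single (fun i => y (e.symm i)) 1 := by
  funext z
  by_cases h : z = fun i => y (e.symm i)
  · subst h
    simp [pull]
  · rw [Pi.single_eq_of_ne h, pull, Pi.single_eq_of_ne]
    intro h'
    exact h (funext fun i => by simp [← h'])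

theorem prepares_queryAbs (w : Fin p ↪ κ) (y y' : Λ → Bits κ)
    (hO : ∀ l, (OA l).1 *ᵥ Pi.single (fun j => y l (w j)) 1 = Pi.single (fun j => y' l (w j)) 1)
    (hy : ∀ l, ∀ i ∉ Set.range w, y l i = y' l i) :
    Prepares e OA OB 0 1 0 (fun l => Pi.single (y l) 1) (fun l => Pi.single (y' l) 1) := by
  refine ⟨[.queryAbs false (w.trans e.toEmbedding)], ?_, ?_, ?_, fun l => ?_⟩
  · simp [Circuit.twoQubitGates, Gate.twoQubitCost]
  · simp [Circuit.absQueries, Gate.absCost]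
  · simp [Circuit.argQueries, Gate.argCost]
  · simp only [Circuit.toMatrix, Gate.toMatrix, one_mul, applyOn_mulVec_pull, Bool.false_eq_true,
      if_false]
    rw [applyOn_mulVec_single w _ (hO l) (hy l)]

theorem prepares_queryArg (w : Fin q ↪ κ) (y y' : Λ → Bits κ)
    (hO : ∀ l, (OB l).1 *ᵥ Pi.single (fun j => y l (w j)) 1 = Pi.single (fun j => y' l (w j)) 1)
    (hy : ∀ l, ∀ i ∉ Set.range w, y l i = y' l i) :
    Prepares e OA OB 0 0 1 (fun l => Pi.single (y l) 1) (fun l => Pi.single (y' l) 1) := by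
  refine ⟨[.queryArg false (w.trans e.toEmbedding)], ?_, ?_, ?_, fun l => ?_⟩
  · simp [Circuit.twoQubitGates, Gate.twoQubitCost]
  · simp [Circuit.absQueries, Gate.absCost]
  · simp [Circuit.argQueries, Gate.argCost]
  · simp only [Circuit.toMatrix, Gate.toMatrix, one_mul, applyOn_mulVec_pull, Bool.false_eq_true,
      if_false]
    rw [applyOn_mulVec_single w _ (hO l) (hy l)]

/-- A gate that writes, depending on the control `ctrl`, the superposition with amplitudes
`amp b false` and `amp b true` on the target `tgt`, which is in state `false`. -/
structure FreshGate (κ : Type) where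
  ctrl : κ
  tgt : κ
  amp : Bool → Bool → ℝ

/-- A real rotation with given first column. -/
def rotation (a : Bool → ℝ) : Matrix Bool Bool ℂ :=
  Matrix.of fun i j => if j then (if i then (a false : ℂ) else -(a true : ℂ)) else (a i : ℂ)

theorem rotation_mem_unitaryGroup {a : Bool → ℝ} (ha : a false ^ 2 + a true ^ 2 = 1) :
    rotation a ∈ Matrix.unitaryGroup Bool ℂ := by
  have h : (a false : ℂ) * a false + a true * a true = 1 := by
    rw [← sq, ← sq]
    exact_mod_cast ha
  rw [Matrix.mem_unitaryGroup_iff']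
  ext i j
  rcases i with _ | _ <;> rcases j with _ | _ <;>
    simp [rotation, Matrix.mul_apply, mul_comm] <;>
    linear_combination h

/-- The product of the amplitudes of a list of gates on fresh qubits. -/
noncomputable def freshAmp (L : List (FreshGate κ)) (x : Bits κ) : ℂ :=
  (L.map fun s => (s.amp (x s.ctrl) (x s.tgt) : ℂ)).prod

/-- No gate before its own touches a target, either as target or as control, so each target is still
`false` when its gate acts. Paths therefore never interfere, and the amplitude is a plain product.
-/
theorem prepares_fresh (L : List (FreshGate κ))
    (hL : L.Pairwise fun s s' => s'.tgt ≠ s.tgt ∧ s'.tgt ≠ s.ctrl)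
    (hne : ∀ s ∈ L, s.ctrl ≠ s.tgt)
    (hamp : ∀ s ∈ L, ∀ b, s.amp b false ^ 2 + s.amp b true ^ 2 = 1)
    (y : Λ → Bits κ) (hy : ∀ l, ∀ s ∈ L, y l s.tgt = false) :
    Prepares e OA OB L.length 0 0 (fun l => Pi.single (y l) 1)
      (fun l x => open Classical in
        if ∀ i, (∀ s ∈ L, i ≠ s.tgt) → x i = y l i then freshAmp L x else 0) := by
  classical
  induction L using List.reverseRecOn with
  | nil =>
    refine (Prepares.refl _).congr (fun _ _ => rfl) fun l x => ?_
    simp [freshAmp, Pi.single_apply, funext_iff]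
  | append_singleton L s ih =>
    rw [List.pairwise_append] at hL
    have ih := ih hL.1 (fun t ht => hne t (by simp [ht])) (fun t ht => hamp t (by simp [ht]))
      fun l t ht => hy l t (by simp [ht])
    have hs : ∀ t ∈ L, s.tgt ≠ t.tgt ∧ s.tgt ≠ t.ctrl := fun t ht => hL.2.2 t ht s (by simp)
    have h1 := ih.trans (prepares_mux (e := e) (OA := OA) (OB := OB) (hne s (by simp))
      (fun b => rotation_mem_unitaryGroup (hamp s (by simp) b)) _)
    rw [List.length_append]
    refine h1.congr (fun _ _ => rfl) fun l x => ?_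
    have hfresh : ∀ b, freshAmp L (Function.update x s.tgt b) = freshAmp L x := by
      intro b
      unfold freshAmp
      congr 1
      refine List.map_congr_left fun t ht => ?_
      rw [Function.update_of_ne (hs t ht).1.symm, Function.update_of_ne (hs t ht).2.symm]
    -- Only the branch with target `false` survives, so only the first column of the rotation
    -- matters.
    have hiff : ∀ b, (∀ i, (∀ t ∈ L, i ≠ t.tgt) → Function.update x s.tgt b i = y l i) ↔
        b = false ∧ ∀ i, (∀ t ∈ L ++ [s], i ≠ t.tgt) → x i = y l i := by
      intro b
      have hys := hy l s (by simp)
      constructor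
      · intro h
        refine ⟨?_, fun i hi => ?_⟩
        · have := h s.tgt fun t ht => (hs t ht).1
          rw [← hys, ← this, Function.update_self]
        · rw [← h i fun t ht => hi t (by simp [ht]), Function.update_of_ne (hi s (by simp))]
      · rintro ⟨rfl, h⟩ i hi
        by_cases his : i = s.tgt
        · rw [his, Function.update_self, hys]
        · rw [Function.update_of_ne his]
          refine h i fun t ht => ?_
          rcases List.mem_append.1 ht with ht | ht
          · exact hi t ht
          · rw [List.mem_singleton.1 ht]
            exact his
    simp only [hiff, hfresh]
    rw [Finset.sum_eq_single false]
    · simp [freshAmp, rotation, mul_comm]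
    · intro b _ hb
      simp [hb]
    · simp

/-- Two preparations from the same initial states give a circuit whose matrix elements are the
inner products of the final states. -/
theorem Prepares.block {g a b g' a' b' : ℕ} {ι : Type} {init φ ψ : Λ × ι → Bits κ → ℂ}
    (hφ : Prepares e (fun l => OA l.1) (fun l => OB l.1) g a b init φ)
    (hψ : Prepares e (fun l => OA l.1) (fun l => OB l.1) g' a' b' init ψ) :
    ∃ c : Circuit p q N, c.twoQubitGates ≤ g' + g ∧ c.absQueries ≤ a' + a ∧
      c.argQueries ≤ b' + b ∧ ∀ l k j,
        star (pull e (init (l, k))) ⬝ᵥ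
          (Circuit.toMatrix (OA l) (OB l) c *ᵥ pull e (init (l, j))) =
        star (φ (l, k)) ⬝ᵥ ψ (l, j) := by
  obtain ⟨c, h1, h2, h3, h4⟩ := hφ
  obtain ⟨d, h1', h2', h3', h4'⟩ := hψ
  obtain ⟨k1, k2, k3⟩ := Circuit.adjoint_costs c
  refine ⟨d ++ c.adjoint, ?_, ?_, ?_, fun l k j => ?_⟩
  · simpa [Circuit.twoQubitGates] using add_le_add h1' (k1.le.trans h1)
  · simpa [Circuit.absQueries] using add_le_add h2' (k2.le.trans h2)
  · simpa [Circuit.argQueries] using add_le_add h3' (k3.le.trans h3)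
  · rw [Circuit.toMatrix_append, Circuit.adjoint_toMatrix, ← Matrix.mulVec_mulVec, h4' (l, j),
      Matrix.dotProduct_mulVec, ← Matrix.star_mulVec, h4 (l, k), pull_dotProduct]

end Prepares

theorem mod_two_pow_succ (m j : ℕ) :
    m % 2 ^ (j + 1) = m % 2 ^ j + 2 ^ j * (m.testBit j).toNat := by
  rw [Nat.mod_pow_succ, Nat.toNat_testBit]

theorem prod_exp_testBit (c : ℂ) (m j : ℕ) :
    ∏ i ∈ Finset.range j, (if m.testBit i then Complex.exp (c * 2 ^ i) else 1) =
      Complex.exp (c * (m % 2 ^ j : ℕ)) := by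
  induction j with
  | zero => simp [Nat.mod_one]
  | succ j ih =>
    rw [Finset.prod_range_succ, ih, mod_two_pow_succ]
    cases m.testBit j
    · simp
    · rw [if_pos rfl, ← Complex.exp_add]
      congr 1
      push_cast
      simp
      ring

/-! ### Transfer-matrix summation along a chain of qubits -/

section Chain

/-- `T j b` is the sum over the qubits below `j` when qubit `j` has the value `b`. The induction
peels off the top qubit and absorbs it into the weight `top`. -/
theorem sum_chain {R : Type*} [CommSemiring R] (F : ℕ → Bool → Bool → R) (T : ℕ → Bool → R) (hT0 : ∀ b, T 0 b = 1)
    (hT : ∀ j b, T (j + 1) b = ∑ b', F j b b' * T j b') (w : ℕ) (top : Bool → R) :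
    ∑ r : Fin (w + 1) → Bool, top (r (Fin.last w)) * ∏ i : Fin w, F i (r i.succ) (r i.castSucc) =
      ∑ b, top b * T w b := by
  induction w generalizing top with
  | zero =>
    rw [← (Equiv.funUnique (Fin 1) Bool).symm.sum_comp]
    simp [hT0]
  | succ w ih =>
    have h := ih fun b' => ∑ b, top b * F w b b'
    simp only [Finset.sum_mul] at h
    rw [← (Fin.snocEquiv fun _ => Bool).sum_comp, Fintype.sum_prod_type_right]
    simp only [Fin.snocEquiv_apply, Fin.prod_univ_castSucc, Fin.snoc_last, Fin.succ_last,
      Fin.snoc_castSucc, Fin.val_castSucc, Fin.val_last, ← Fin.castSucc_succ]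
    calc _ = _ := by
          refine Finset.sum_congr rfl fun x _ => Finset.sum_congr rfl fun b _ => ?_
          rw [mul_comm (∏ i : Fin w, _), ← mul_assoc]
      _ = _ := h
      _ = _ := by
          rw [Finset.sum_comm]
          simp only [hT, Finset.mul_sum, mul_assoc]

end Chain

/-! ### The Fourier transform of the index register -/

section Fourier

variable {κ : Type} [Fintype κ] [DecidableEq κ] {p q N : ℕ} {Λ : Type}
  {e : κ ≃ Fin N} {OA : Λ → QUnitary (Fin p)} {OB : Λ → QUnitary (Fin q)}

/-- The amplitude of the value `b` of the qubit `i` in the Fourier transform of the basis state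
labelled by `m`. -/
noncomputable def fourierAmp (m i : ℕ) (b : Bool) : ℂ :=
  (Real.sqrt 2 : ℂ)⁻¹ * (if m.testBit i then Complex.exp (-(Real.pi * Complex.I) * 2 ^ i) else 1) *
    if b then Complex.exp (2 * Real.pi * Complex.I * (m / 2 ^ (i + 1))) else 1

/-- The one-qubit gate of the Fourier transform at the qubit `i`: a phase and a Hadamard gate. -/
noncomputable def fourierGate (i : ℕ) : Matrix Bool Bool ℂ :=
  Matrix.of fun b b' =>
    (Real.sqrt 2 : ℂ)⁻¹ * (if b' then Complex.exp (-(Real.pi * Complex.I) * 2 ^ i) else 1) *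
      if b && b' then -1 else 1

theorem norm_exp_pi_two_pow (i : ℕ) : ‖Complex.exp (-(Real.pi * Complex.I) * 2 ^ i)‖ = 1 := by
  rw [show (-(Real.pi * Complex.I) * 2 ^ i : ℂ) = ((-(Real.pi * 2 ^ i) : ℝ) : ℂ) * Complex.I by
    push_cast; ring, Complex.norm_exp_ofReal_mul_I]

theorem fourierGate_mem_unitaryGroup (i : ℕ) :
    fourierGate i ∈ Matrix.unitaryGroup Bool ℂ := by
  have h2 : (Real.sqrt 2 : ℂ)⁻¹ * (Real.sqrt 2 : ℂ)⁻¹ = 1 / 2 := by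
    rw [← mul_inv, ← Complex.ofReal_mul, Real.mul_self_sqrt (by norm_num)]
    norm_num
  have hz' : (starRingEnd ℂ) (Complex.exp (-(Real.pi * Complex.I) * 2 ^ i)) *
      Complex.exp (-(Real.pi * Complex.I) * 2 ^ i) = 1 := by
    rw [Complex.conj_mul', norm_exp_pi_two_pow i]
    simp
  rw [Matrix.mem_unitaryGroup_iff']
  obtain ⟨z, hzz⟩ : ∃ z, z = Complex.exp (-(Real.pi * Complex.I) * 2 ^ i) := ⟨_, rfl⟩
  rw [← hzz] at hz'
  ext b b'
  rcases b with _ | _ <;> rcases b' with _ | _ <;>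
    simp only [fourierGate, ← hzz, Matrix.mul_apply, Matrix.star_apply, Matrix.of_apply,
      Fintype.sum_bool, RCLike.star_def, map_mul, map_inv₀, Complex.conj_ofReal] <;> simp <;>
    grind

/-- Split `m / 2^(j+1)` into its integer part, the contribution of the bits below `j`, and half of
bit `j`. The first disappears in the exponential, the second is the controlled phases, and the third
is the Hadamard sign. -/
theorem fourierGate_mul_phases (m j : ℕ) (b : Bool) :
    fourierGate j b (m.testBit j) * ∏ i : Fin j,
        (if m.testBit i && b then
          Complex.exp (2 * Real.pi * Complex.I / 2 ^ (j + 1) * 2 ^ (i : ℕ)) else 1) =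
      fourierAmp m j b := by
  have hp : ∀ c : ℂ, ∏ i : Fin j, (if m.testBit i then Complex.exp (c * 2 ^ (i : ℕ)) else 1) =
      Complex.exp (c * (m % 2 ^ j : ℕ)) := fun c => by
    rw [← prod_exp_testBit, Finset.prod_range]
  cases b
  · simp [fourierGate, fourierAmp]
  · simp only [Bool.and_true, hp, fourierGate, Matrix.of_apply, fourierAmp, if_true, Bool.true_and]
    rw [mul_assoc]
    congr 1
    have h : (m : ℂ) / 2 ^ (j + 1) = (m / 2 ^ (j + 1) : ℕ) +
        (m % 2 ^ j : ℕ) / 2 ^ (j + 1) + (m.testBit j).toNat / 2 := by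
      have := Nat.div_add_mod m (2 ^ (j + 1))
      rw [mod_two_pow_succ] at this
      conv_lhs => rw [← this]
      push_cast
      field_simp
      ring
    rw [h, mul_add, mul_add, Complex.exp_add, Complex.exp_add,
      mul_comm (2 * Real.pi * Complex.I) ((m / 2 ^ (j + 1) : ℕ) : ℂ),
      Complex.exp_nat_mul_two_pi_mul_I, one_mul, mul_comm]
    congr 1
    · congr 1
      ring
    · cases m.testBit j
      · simp
      · simp only [if_true, Bool.toNat_true]
        rw [← Complex.exp_pi_mul_I]
        congr 1
        push_cast
        ring

/-- The Fourier transform on the qubits `Q`, in place and with reversed order of the qubits. -/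
theorem prepares_fourier {r : ℕ} (Q : Fin r ↪ κ) (a₀ : κ) (ha₀ : a₀ ∉ Set.range Q)
    (m : Λ → ℕ) (ρ : Λ → Bits κ → ℂ)
    (hρ : ∀ l x i b, ρ l (Function.update x (Q i) b) = ρ l x) :
    Prepares e OA OB (r * r) 0 0
      (fun l x => if ∀ i, x (Q i) = (m l).testBit i then ρ l x else 0)
      (fun l x => (∏ i : Fin r, fourierAmp (m l) i (x (Q i))) * ρ l x) := by
  -- The qubits `i ≥ j` are already transformed. Going downwards, the controls for qubit `j` are
  -- lower qubits, which still hold bits of `m`.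
  have main : ∀ j ≤ r, Prepares e OA OB (j * r) 0 0
      (fun l x => if ∀ i : Fin r, i.1 < j → x (Q i) = (m l).testBit i then
        (∏ i : Fin r, if j ≤ i.1 then fourierAmp (m l) i (x (Q i)) else 1) * ρ l x else 0)
      (fun l x => (∏ i : Fin r, fourierAmp (m l) i (x (Q i))) * ρ l x) := by
    intro j hj
    induction j with
    | zero => exact ((Prepares.refl _).congr (fun _ _ => rfl) fun l x => by simp).mono (by simp) le_rfl le_rfl
    | succ j ih =>
      have hne : ∀ i, a₀ ≠ Q i := fun i h => ha₀ ⟨i, h.symm⟩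
      have h1 := prepares_mux (e := e) (OA := OA) (OB := OB) (hne ⟨j, hj⟩)
        (fun _ => fourierGate_mem_unitaryGroup j)
        (fun l x => if ∀ i : Fin r, i.1 < j + 1 → x (Q i) = (m l).testBit i then
          (∏ i : Fin r, if j + 1 ≤ i.1 then fourierAmp (m l) i (x (Q i)) else 1) * ρ l x else 0)
      have h2 := h1.trans (prepares_phases (Finset.univ : Finset (Fin j))
        (fun i => Q (Fin.castLE (by omega) i)) (fun _ => Q ⟨j, hj⟩)
        (fun i b b' => if b && b' then
          Complex.exp (2 * Real.pi * Complex.I / 2 ^ (j + 1) * 2 ^ (i : ℕ)) else 1)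
        (fun i _ => by
          rw [Ne, Q.injective.eq_iff, Fin.ext_iff]
          exact i.2.ne)
        (fun i _ b b' => by
          split_ifs
          · rw [show (2 * Real.pi * Complex.I / 2 ^ (j + 1) * 2 ^ (i : ℕ) : ℂ) =
              ((2 * Real.pi / 2 ^ (j + 1) * 2 ^ (i : ℕ) : ℝ) : ℂ) * Complex.I by
                push_cast; ring, Complex.norm_exp_ofReal_mul_I]
          · simp) _)
      refine ((h2.congr (fun _ _ => rfl) fun l x => ?_).trans (ih (by omega))).mono ?_ le_rfl le_rfl
      · have hupd : ∀ b (i : Fin r), Function.update x (Q ⟨j, hj⟩) b (Q i) =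
            if i.1 = j then b else x (Q i) := by
          intro b i
          by_cases hi : i.1 = j
          · obtain rfl : i = ⟨j, hj⟩ := Fin.ext hi
            simp
          · rw [if_neg hi, Function.update_of_ne]
            rw [Ne, Q.injective.eq_iff, Fin.ext_iff]
            exact hi
        have hiff : ∀ b, (∀ i : Fin r, i.1 < j + 1 →
            Function.update x (Q ⟨j, hj⟩) b (Q i) = (m l).testBit i) ↔
            b = (m l).testBit j ∧ ∀ i : Fin r, i.1 < j → x (Q i) = (m l).testBit i := by
          intro b
          simp only [hupd]
          constructor
          · intro h
            refine ⟨by simpa using h ⟨j, hj⟩ (Nat.lt_succ_self j), fun i hi => ?_⟩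
            simpa [hi.ne] using h i (by omega)
          · rintro ⟨rfl, h⟩ i hi
            split_ifs with h'
            · rw [h']
            · exact h i (by omega)
        have hprod : ∀ b, (∏ i : Fin r, if j + 1 ≤ i.1 then
              fourierAmp (m l) i (Function.update x (Q ⟨j, hj⟩) b (Q i)) else 1) =
            ∏ i : Fin r, if j + 1 ≤ i.1 then fourierAmp (m l) i (x (Q i)) else 1 := by
          intro b
          refine Finset.prod_congr rfl fun i _ => ?_
          rw [hupd]
          split_ifs with h h' <;> first | rfl | omega
        have hsplit : (∏ i : Fin r, if j ≤ i.1 then fourierAmp (m l) i (x (Q i)) else 1) =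
            fourierAmp (m l) j (x (Q ⟨j, hj⟩)) *
              ∏ i : Fin r, if j + 1 ≤ i.1 then fourierAmp (m l) i (x (Q i)) else 1 := by
          rw [← Finset.mul_prod_erase _ _ (Finset.mem_univ (⟨j, hj⟩ : Fin r)),
            ← Finset.mul_prod_erase _ (fun i : Fin r => if j + 1 ≤ i.1 then _ else _)
              (Finset.mem_univ (⟨j, hj⟩ : Fin r))]
          simp only [le_refl, if_true, Nat.not_succ_le_self, if_false, one_mul]
          congr 1
          refine Finset.prod_congr rfl fun i hi => ?_
          have : i.1 ≠ j := fun h => (Finset.mem_erase.1 hi).1 (Fin.ext h)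
          congr 1
          rw [eq_iff_iff]
          omega
        simp only [hiff, hprod, hρ]
        rw [Finset.sum_eq_single ((m l).testBit j)]
        · by_cases hx : ∀ i : Fin r, i.1 < j → x (Q i) = (m l).testBit i
          · rw [if_pos hx, if_pos ⟨rfl, hx⟩, hsplit, ← fourierGate_mul_phases]
            have : ∀ i : Fin j, x (Q (Fin.castLE (by omega) i)) = (m l).testBit i :=
              fun i => hx _ i.2
            simp only [this]
            ring
          · rw [if_neg hx, if_neg fun h => hx h.2]
            simp
        · intro b _ hb
          rw [if_neg fun h => hb h.1, mul_zero]
        · simp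
      · rw [Finset.card_univ, Fintype.card_fin, add_mul, one_mul]
        omega
  refine (main r le_rfl).congr (fun l x => ?_) fun _ _ => rfl
  simp only [Fin.is_lt, forall_const]
  rw [Finset.prod_eq_one fun i _ => if_neg (by omega), one_mul]

/-- Qubit `i` carries the phase `m / 2^(i+1)` and hence has weight `2^(r-1-i)` in the sample number,
which explains the bit reversal. The factors `e^{-iπ 2^i}` multiply to `e^{-iπm}`, the offset `π` of
the sample points. -/
theorem prod_fourierAmp {r m : ℕ} (hm : m < 2 ^ r) (b : Fin r → Bool) :
    ∏ i : Fin r, fourierAmp m i (b i) = (Real.sqrt 2 : ℂ)⁻¹ ^ r *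
      Complex.exp (-(Complex.I * m * (Real.pi - 2 * Real.pi / 2 ^ r *
        Nat.ofBits fun j => b j.rev))) := by
  have h1 : ∏ i : Fin r, (if m.testBit i then
      Complex.exp (-(Real.pi * Complex.I) * 2 ^ (i : ℕ)) else 1) =
      Complex.exp (-(Real.pi * Complex.I) * m) := by
    have := prod_exp_testBit (-(Real.pi * Complex.I)) m r
    rwa [Finset.prod_range, Nat.mod_eq_of_lt hm] at this
  have h2 : ∏ i : Fin r, (if b i then
      Complex.exp (2 * Real.pi * Complex.I * (m / 2 ^ ((i : ℕ) + 1))) else 1) =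
      Complex.exp (2 * Real.pi * Complex.I * m / 2 ^ r * (Nat.ofBits fun j => b j.rev)) := by
    have := prod_exp_testBit (2 * Real.pi * Complex.I * m / 2 ^ r) (Nat.ofBits fun j => b j.rev) r
    rw [Finset.prod_range, Nat.mod_eq_of_lt (Nat.ofBits_lt_two_pow _)] at this
    rw [← this, ← Equiv.prod_comp Fin.revPerm]
    refine Finset.prod_congr rfl fun i _ => ?_
    rw [Nat.testBit_ofBits_lt _ _ i.2, Fin.revPerm_apply, Fin.val_rev]
    congr 2
    have : (2 : ℂ) ^ r = 2 ^ (r - (i.1 + 1) + 1) * 2 ^ i.1 := by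
      rw [← pow_add]
      congr 1
      omega
    rw [this]
    field_simp
  simp only [fourierAmp, Finset.prod_mul_distrib, h1, h2, Finset.prod_const, Finset.card_univ,
    Fintype.card_fin]
  rw [mul_assoc, ← Complex.exp_add]
  congr 2
  ring

end Fourier

section Index

variable {κ : Type} [Fintype κ] [DecidableEq κ] {p q N : ℕ} {Λ : Type}
  {e : κ ≃ Fin N} {OA : Λ → QUnitary (Fin p)} {OB : Λ → QUnitary (Fin q)}

/-- Preparation of ancillas, diagonal gates, and a Fourier transform of the register `Q`. -/
theorem prepares_fresh_phases_fourier {r : ℕ} (Q : Fin r ↪ κ) (a₀ : κ) (ha₀ : a₀ ∉ Set.range Q)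
    (m : Λ → ℕ) (L : List (FreshGate κ))
    (hL : L.Pairwise fun s s' => s'.tgt ≠ s.tgt ∧ s'.tgt ≠ s.ctrl)
    (hne : ∀ s ∈ L, s.ctrl ≠ s.tgt)
    (hamp : ∀ s ∈ L, ∀ b, s.amp b false ^ 2 + s.amp b true ^ 2 = 1)
    (hQ : ∀ s ∈ L, s.ctrl ∉ Set.range Q ∧ s.tgt ∉ Set.range Q)
    {ι : Type} (S : Finset ι) (c t : ι → κ) (d : ι → Bool → Bool → ℂ)
    (hct : ∀ i ∈ S, c i ≠ t i) (hd : ∀ i ∈ S, ∀ b b', ‖d i b b'‖ = 1) :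
    Prepares e OA OB (L.length + S.card + r * r) 0 0
      (fun l => Pi.single (Function.extend Q (fun i => (m l).testBit i) fun _ => false) 1)
      (fun l x => (∏ i : Fin r, fourierAmp (m l) i (x (Q i))) * open Classical in
        ((∏ i ∈ S, d i (Function.extend Q (fun i => (m l).testBit i) x (c i))
            (Function.extend Q (fun i => (m l).testBit i) x (t i))) *
          if ∀ i ∉ Set.range Q, (∀ s ∈ L, i ≠ s.tgt) → x i = false then freshAmp L x else 0)) := by
  classical
  have hext : ∀ (m : ℕ) (x : Bits κ) (i : Fin r),
      Function.extend Q (fun i : Fin r => m.testBit i) x (Q i) = m.testBit i :=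
    fun m x i => Q.injective.extend_apply _ _ i
  have hext' : ∀ (m : ℕ) (x : Bits κ), ∀ i ∉ Set.range Q,
      Function.extend Q (fun i : Fin r => m.testBit i) x i = x i :=
    fun m x i hi => Function.extend_apply' _ _ _ hi
  have h1 := prepares_fresh (e := e) (OA := OA) (OB := OB) L hL hne hamp
    (fun l => Function.extend Q (fun i => (m l).testBit i) fun _ => false)
    (fun l s hs => hext' _ _ _ (hQ s hs).2)
  have h2 := h1.trans (prepares_phases S c t d hct hd _)
  have hupd : ∀ (x : Bits κ) (i : Fin r) (b : Bool), ∀ i' ∉ Set.range Q, Function.update x (Q i) b i' = x i' := by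
    intro x i b i' hi'
    refine Function.update_of_ne ?_ _ _
    rintro rfl
    exact hi' ⟨i, rfl⟩
  -- The spectator factor must not depend on the transformed qubits. The diagonal gates act before
  -- the transform, so the index bits they read are written as those of `m`.
  have h3 := prepares_fourier (e := e) (OA := OA) (OB := OB) Q a₀ ha₀ m
    (fun l x => (∏ i ∈ S, d i (Function.extend Q (fun i => (m l).testBit i) x (c i))
            (Function.extend Q (fun i => (m l).testBit i) x (t i))) *
          if ∀ i ∉ Set.range Q, (∀ s ∈ L, i ≠ s.tgt) → x i = false then freshAmp L x else 0)
    (by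
      intro l x i b
      have e1 : Function.extend Q (fun i => (m l).testBit i) (Function.update x (Q i) b) =
          Function.extend Q (fun i => (m l).testBit i) x := by
        funext j
        by_cases hj : j ∈ Set.range Q
        · obtain ⟨j, rfl⟩ := hj
          rw [hext, hext]
        · rw [hext' _ _ _ hj, hext' _ _ _ hj, hupd _ _ _ _ hj]
      have e2 : freshAmp L (Function.update x (Q i) b) = freshAmp L x := by
        unfold freshAmp
        congr 1
        refine List.map_congr_left fun s hs => ?_
        rw [hupd _ _ _ _ (hQ s hs).1, hupd _ _ _ _ (hQ s hs).2]
      have e3 : (∀ i' ∉ Set.range Q, (∀ s ∈ L, i' ≠ s.tgt) →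
          Function.update x (Q i) b i' = false) ↔
          ∀ i' ∉ Set.range Q, (∀ s ∈ L, i' ≠ s.tgt) → x i' = false := by
        refine forall₂_congr fun i' hi' => ?_
        rw [hupd _ _ _ _ hi']
      simp only [e1, e2, e3])
  refine ((h2.congr (fun _ _ => rfl) fun l x => ?_).trans h3).mono (by omega) le_rfl le_rfl
  have hiff : (∀ i, (∀ s ∈ L, i ≠ s.tgt) →
      x i = Function.extend Q (fun i => (m l).testBit i) (fun _ => false) i) ↔
      (∀ i, x (Q i) = (m l).testBit i) ∧
        ∀ i ∉ Set.range Q, (∀ s ∈ L, i ≠ s.tgt) → x i = false := by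
    constructor
    · refine fun h => ⟨fun i => ?_, fun i hi hs => ?_⟩
      · rw [h (Q i) fun s hs h' => (hQ s hs).2 ⟨i, h'⟩, hext]
      · rw [h i hs, hext' _ _ _ hi]
    · rintro ⟨h, h'⟩ i hs
      by_cases hi : i ∈ Set.range Q
      · obtain ⟨i, rfl⟩ := hi
        rw [hext, h]
      · rw [hext' _ _ _ hi, h' i hi hs]
  by_cases hx : ∀ i, x (Q i) = (m l).testBit i
  · have hxx : Function.extend Q (fun i => (m l).testBit i) x = x := by
      funext j
      by_cases hj : j ∈ Set.range Q
      · obtain ⟨j, rfl⟩ := hj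
        rw [hext, hx]
      · rw [hext' _ _ _ hj]
    simp only [hiff, hxx, if_pos hx]
    congr 1
    simp [hx]
  · rw [if_neg hx, if_neg fun h => hx (hiff.1 h).1, mul_zero]

end Index

/-! ### Triangular truncation and binary fractions as mixtures of signs -/

section Amplitudes

/-- The sign of a controlled `Z` gate. -/
def czSign (b b' : Bool) : ℝ := if b && b' then -1 else 1

/-- The amplitudes with which the level qubit `i` stops (`false`) or goes on (`true`), if the
previous one goes on. -/
noncomputable def stepAmp (σ : ℝ) (i : ℕ) (b b' : Bool) : ℝ :=
  if b then (if b' then Real.sqrt ((i + 1) / (i + 2)) else σ * Real.sqrt (1 / (i + 2)))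
  else if b' then 0 else 1

/-- The amplitudes of a controlled Hadamard gate on a fresh qubit. -/
noncomputable def halfAmp (b b' : Bool) : ℝ :=
  if b then Real.sqrt (1 / 2) else if b' then 0 else 1

theorem stepAmp_sq {σ : ℝ} (hσ : σ ^ 2 = 1) (i : ℕ) (b : Bool) :
    stepAmp σ i b false ^ 2 + stepAmp σ i b true ^ 2 = 1 := by
  cases b
  · simp [stepAmp]
  · simp only [stepAmp, if_true, Bool.false_eq_true, if_false, mul_pow, hσ, one_mul]
    rw [Real.sq_sqrt (by positivity), Real.sq_sqrt (by positivity)]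
    field_simp
    ring

theorem halfAmp_sq (b : Bool) : halfAmp b false ^ 2 + halfAmp b true ^ 2 = 1 := by
  cases b
  · simp [halfAmp]
  · simp only [halfAmp, if_true]
    rw [Real.sq_sqrt (by positivity)]
    norm_num

/-- The amplitude of the level register `r` and the sign register `h`. -/
noncomputable def levelAmp (w : ℕ) (σ : ℝ) (r : Fin (w + 1) → Bool) (h : Fin w → Bool) : ℝ :=
  stepAmp 1 w true (r (Fin.last w)) * ((∏ i : Fin w, stepAmp σ i (r i.succ) (r i.castSucc)) *
    ∏ i : Fin w, halfAmp (r i.succ) (h i))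

/-- The sign by which the basis state labelled by `m` is multiplied on the right. -/
def rightSign (w m : ℕ) (h : Fin w → Bool) : ℝ := ∏ i : Fin w, czSign (h i) (m.testBit i)

/-- The sign by which the basis state labelled by `m` is multiplied on the left. -/
def leftSign (w m : ℕ) (r : Fin (w + 1) → Bool) (h : Fin w → Bool) : ℝ :=
  ∏ i : Fin w, czSign (h i) (m.testBit i) * czSign (r i.succ) (m.testBit i) *
    czSign (r i.castSucc) (m.testBit i) * czSign (h i) (r i.succ) * czSign (h i) (r i.castSucc)

/-- The top bit decides the comparison unless it is tied; this drives the recursion for the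
truncation signs. -/
theorem le_mod_two_pow_succ (k l j : ℕ) : l % 2 ^ (j + 1) ≤ k % 2 ^ (j + 1) ↔
    if l.testBit j = k.testBit j then l % 2 ^ j ≤ k % 2 ^ j else k.testBit j = true := by
  have h1 := Nat.mod_lt k (Nat.two_pow_pos j)
  have h2 := Nat.mod_lt l (Nat.two_pow_pos j)
  rw [mod_two_pow_succ, mod_two_pow_succ]
  cases l.testBit j <;> cases k.testBit j <;> simp <;> omega

/-- The Schur multiplier of the triangular truncation as a mixture of signs. -/
theorem sum_levelAmp {w k l : ℕ} (hk : k < 2 ^ w) (hl : l < 2 ^ w) :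
    ∑ r : Fin (w + 1) → Bool, ∑ h : Fin w → Bool,
      (levelAmp w (-1) r h * leftSign w k r h) * (levelAmp w 1 r h * rightSign w l h) =
      if l ≤ k then 2 / ((w : ℝ) + 2) else 0 := by
  -- Summed over the sign qubit, `G` is `(1 + (-1)^{k_j + l_j})/2` when both levels go on, and
  -- `((-1)^{k_j} - (-1)^{l_j})/2` when the chain stops here. The amplitude `σ = -1` on the left
  -- corrects the sign of the latter.
  let G : ℕ → Bool → Bool → Bool → ℝ := fun j b b' h =>
    (halfAmp b h * (czSign h (k.testBit j) * czSign b (k.testBit j) *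
      czSign b' (k.testBit j) * czSign h b * czSign h b')) * (halfAmp b h * czSign h (l.testBit j))
  let F : ℕ → Bool → Bool → ℝ := fun j b b' =>
    stepAmp (-1) j b b' * stepAmp 1 j b b' * ∑ h, G j b b' h
  -- For a running chain this is `s_j / (j + 1)`, the comparison sign over its total weight; a
  -- stopped chain contributes `1`. The probabilities `(j + 1)/(j + 2)` and `1/(j + 2)` are the
  -- relative weights of the two terms of the recursion.
  let T : ℕ → Bool → ℝ := fun j b =>
    if b then (if l % 2 ^ j ≤ k % 2 ^ j then 1 else -1) / ((j : ℝ) + 1) else 1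
  have h1 : ∀ r : Fin (w + 1) → Bool, ∑ h : Fin w → Bool,
      (levelAmp w (-1) r h * leftSign w k r h) * (levelAmp w 1 r h * rightSign w l h) =
      stepAmp 1 w true (r (Fin.last w)) ^ 2 * ∏ i : Fin w, F i (r i.succ) (r i.castSucc) := by
    intro r
    simp only [F, Finset.prod_mul_distrib]
    rw [Finset.prod_univ_sum, Fintype.piFinset_univ, Finset.mul_sum, Finset.mul_sum]
    refine Finset.sum_congr rfl fun h _ => ?_
    simp only [levelAmp, leftSign, rightSign, G, Finset.prod_mul_distrib]
    ring
  have hs : ∀ j : ℕ, Real.sqrt ((j + 1) / (j + 2)) * Real.sqrt ((j + 1) / (j + 2)) =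
      ((j : ℝ) + 1) / (j + 2) := fun j => Real.mul_self_sqrt (by positivity)
  have hs' : ∀ j : ℕ, Real.sqrt (1 / (j + 2)) * Real.sqrt (1 / (j + 2)) =
      1 / ((j : ℝ) + 2) := fun j => Real.mul_self_sqrt (by positivity)
  have hh : Real.sqrt (1 / 2) * Real.sqrt (1 / 2) = 1 / 2 := Real.mul_self_sqrt (by positivity)
  have hT : ∀ j b, T (j + 1) b = ∑ b', F j b b' * T j b' := by
    intro j b
    have hj : ((j : ℝ) + 1) ≠ 0 := by positivity
    have hj' : ((j : ℝ) + 2) ≠ 0 := by positivity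
    cases b
    · simp [T, F, G, stepAmp, halfAmp, czSign]
    · have hF1 : F j true true =
          (j + 1) / (j + 2) * if l.testBit j = k.testBit j then 1 else 0 := by
        rw [← hs]
        simp only [F, G, stepAmp, halfAmp, Fintype.sum_bool, if_true]
        generalize Real.sqrt (1 / 2) = c at hh ⊢
        generalize Real.sqrt ((j + 1) / (j + 2)) = a
        generalize Real.sqrt (1 / (j + 2)) = b
        cases l.testBit j <;> cases k.testBit j <;> simp [czSign] <;>
          linear_combination (2 * a * a) * hh
      have hF0 : F j true false = 1 / (j + 2) *
          if l.testBit j = k.testBit j then 0 else if k.testBit j then 1 else -1 := by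
        rw [← hs']
        simp only [F, G, stepAmp, halfAmp, Fintype.sum_bool, if_true]
        generalize Real.sqrt (1 / 2) = c at hh ⊢
        generalize Real.sqrt ((j + 1) / (j + 2)) = a
        generalize Real.sqrt (1 / (j + 2)) = b
        cases l.testBit j <;> cases k.testBit j <;> simp [czSign]
        · linear_combination (2 * b * b) * hh
        · linear_combination (2 * b * b) * hh
      rw [Fintype.sum_bool, hF1, hF0]
      simp only [T, le_mod_two_pow_succ, if_true, Bool.false_eq_true, if_false]
      push_cast
      split_ifs <;> field_simp <;> ring
  simp only [h1]
  -- The top qubit mixes `s_w` with the constant `1`: `(w+1)/(w+2) · s_w/(w+1) + 1/(w+2) = (1 +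
  -- s_w)/(w+2)`.
  rw [sum_chain F T (fun b => by cases b <;> simp [T, Nat.mod_one]) hT w
    fun b => stepAmp 1 w true b ^ 2]
  have := hs w
  have := hs' w
  simp only [T, Fintype.sum_bool, stepAmp, if_true, Bool.false_eq_true, if_false,
    Nat.mod_eq_of_lt hk, Nat.mod_eq_of_lt hl, one_mul]
  rw [Real.sq_sqrt (by positivity), Real.sq_sqrt (by positivity)]
  split_ifs <;> field_simp <;> norm_num

/-- The amplitude of the threshold register `r`. -/
noncomputable def thresholdAmp (t : ℕ) (r : Fin (t + 1) → Bool) : ℝ :=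
  halfAmp true (r (Fin.last t)) * ∏ i : Fin t, halfAmp (r i.succ) (r i.castSucc)

/-- The sign by which the threshold register is multiplied if the value register holds `v`. -/
def thresholdSign (t v : ℕ) (r : Fin (t + 1) → Bool) : ℝ :=
  czSign (r (Fin.last t)) (r (Fin.last t)) *
    ∏ i : Fin t, czSign (v.testBit i) (r i.succ) * czSign (v.testBit i) (r i.castSucc)

/-- Each level stops with probability `1/2` and then reads the sign `(-1)^{v_i} = 1 - 2 v_i`, so a
running chain averages to `1 - 2v/2^t`. The top qubit averages the constant `1` with minus this
value. -/
theorem sum_thresholdAmp {t v : ℕ} (hv : v < 2 ^ t) :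
    ∑ r : Fin (t + 1) → Bool, thresholdAmp t r * thresholdAmp t r * thresholdSign t v r =
      v / 2 ^ t := by
  let F : ℕ → Bool → Bool → ℝ := fun j b b' =>
    halfAmp b b' * halfAmp b b' * (czSign (v.testBit j) b * czSign (v.testBit j) b')
  let T : ℕ → Bool → ℝ := fun j b => if b then 1 - 2 * ((v % 2 ^ j : ℕ) / 2 ^ j) else 1
  have hh : Real.sqrt (1 / 2) * Real.sqrt (1 / 2) = 1 / 2 := Real.mul_self_sqrt (by positivity)
  have h1 : ∀ r : Fin (t + 1) → Bool,
      thresholdAmp t r * thresholdAmp t r * thresholdSign t v r =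
      halfAmp true (r (Fin.last t)) * halfAmp true (r (Fin.last t)) *
        czSign (r (Fin.last t)) (r (Fin.last t)) *
        ∏ i : Fin t, F i (r i.succ) (r i.castSucc) := by
    intro r
    simp only [F, thresholdAmp, thresholdSign, Finset.prod_mul_distrib]
    ring
  have hT : ∀ j b, T (j + 1) b = ∑ b', F j b b' * T j b' := by
    intro j b
    cases b
    · cases v.testBit j <;> simp [T, F, halfAmp, czSign]
    · simp only [T, F, mod_two_pow_succ, Fintype.sum_bool, halfAmp, if_true,
        Bool.false_eq_true, if_false, hh]
      push_cast
      cases v.testBit j <;> simp [czSign] <;> field_simp <;> ring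
  simp only [h1]
  rw [sum_chain F T (fun b => by cases b <;> simp [T, Nat.mod_one]) hT t
    fun b => halfAmp true b * halfAmp true b * czSign b b]
  simp only [T, Fintype.sum_bool, halfAmp, if_true, Bool.false_eq_true, if_false, hh,
    Nat.mod_eq_of_lt hv, czSign, Bool.and_self]
  ring

end Amplitudes

/-! ### Qubit registers and the index states -/

section Layout

/-- The qubits of the index register, of the level register, of the sign register, and one more
qubit for the normalization. -/
abbrev IndexQubits (r w : ℕ) : Type := Fin r ⊕ (Fin (w + 1) ⊕ (Fin w ⊕ Unit))

/-- The qubits of the threshold register, and those of the first and of the output registers of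
the oracles. -/
abbrev ValueQubits (m t u : ℕ) : Type := Fin (t + 1) ⊕ (Fin m ⊕ (Fin t ⊕ Fin u))

/-- All qubits of the circuit. -/
abbrev Qubits (r w m t u : ℕ) : Type := IndexQubits r w ⊕ ValueQubits m t u

variable {r w m t u : ℕ}

/-- A qubit of the index register. -/
abbrev Qubits.index (i : Fin r) : Qubits r w m t u := .inl (.inl i)

/-- A qubit of the level register. -/
abbrev Qubits.level (i : Fin (w + 1)) : Qubits r w m t u := .inl (.inr (.inl i))

/-- A qubit of the sign register. -/
abbrev Qubits.sign (i : Fin w) : Qubits r w m t u := .inl (.inr (.inr (.inl i)))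

/-- The qubit for the normalization. -/
abbrev Qubits.scale : Qubits r w m t u := .inl (.inr (.inr (.inr ())))

/-- A qubit of the threshold register. -/
abbrev Qubits.threshold (i : Fin (t + 1)) : Qubits r w m t u := .inr (.inl i)

/-- A qubit of the output register for the absolute value. -/
abbrev Qubits.outAbs (i : Fin t) : Qubits r w m t u := .inr (.inr (.inr (.inl i)))

/-- A qubit of the output register for the argument. -/
abbrev Qubits.outArg (i : Fin u) : Qubits r w m t u := .inr (.inr (.inr (.inr i)))

/-- The index register. -/
def Qubits.indexEmbedding : Fin r ↪ Qubits r w m t u := ⟨Qubits.index, fun _ _ h => by simpa using h⟩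

theorem not_mem_range_index (i : Fin (w + 1) ⊕ (Fin w ⊕ Unit)) :
    (Sum.inl (Sum.inr i) : Qubits r w m t u) ∉ Set.range Qubits.indexEmbedding := by
  rintro ⟨j, hj⟩
  exact Sum.inl_ne_inr (Sum.inl_injective hj)

theorem inr_not_mem_range_index (i : ValueQubits m t u) :
    (Sum.inr i : Qubits r w m t u) ∉ Set.range Qubits.indexEmbedding := by
  rintro ⟨j, hj⟩
  exact Sum.inl_ne_inr hj

/-- The register contents `x`, with the index register set to `l`. -/
def setIndex (l : ℕ) (x : Bits (Qubits r w m t u)) : Bits (Qubits r w m t u) :=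
  Sum.elim (Sum.elim (encode r l) fun i => x (.inl (.inr i))) fun i => x (.inr i)

/-- The gates that prepare the level, sign and normalization registers. -/
noncomputable def indexGates (r w m t u : ℕ) (σ : ℝ) (τ : Bool → ℝ) :
    List (FreshGate (Qubits r w m t u)) :=
  ⟨.threshold (Fin.last t), .level (Fin.last w), fun _ => stepAmp 1 w true⟩ ::
    ((List.finRange w).reverse.map fun i => ⟨.level i.succ, .level i.castSucc, stepAmp σ i⟩) ++
    ((List.finRange w).map fun i => ⟨.level i.succ, .sign i, halfAmp⟩) ++
    [⟨.level (Fin.last w), .scale, fun _ => τ⟩]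

theorem mem_indexGates {σ : ℝ} {τ : Bool → ℝ} {s : FreshGate (Qubits r w m t u)} :
    s ∈ indexGates r w m t u σ τ ↔
      s = ⟨.threshold (Fin.last t), .level (Fin.last w), fun _ => stepAmp 1 w true⟩ ∨
      (∃ i : Fin w, s = ⟨.level i.succ, .level i.castSucc, stepAmp σ i⟩) ∨
      (∃ i : Fin w, s = ⟨.level i.succ, .sign i, halfAmp⟩) ∨
      s = ⟨.level (Fin.last w), .scale, fun _ => τ⟩ := by
  simp only [indexGates, List.cons_append, List.mem_cons, List.mem_append, List.mem_map,
    List.mem_reverse, List.mem_finRange, true_and, or_assoc, List.not_mem_nil, or_false,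
    eq_comm (b := s)]

theorem indexGates_length (σ : ℝ) (τ : Bool → ℝ) :
    (indexGates r w m t u σ τ).length = 2 * w + 2 := by
  simp [indexGates]
  ring

theorem indexGates_pairwise (σ : ℝ) (τ : Bool → ℝ) :
    (indexGates r w m t u σ τ).Pairwise fun s s' => s'.tgt ≠ s.tgt ∧ s'.tgt ≠ s.ctrl := by
  have hlt := List.pairwise_lt_finRange w
  simp only [indexGates, List.cons_append, List.pairwise_cons, List.pairwise_append,
    List.pairwise_map, List.pairwise_reverse, List.mem_append, List.mem_map, List.mem_reverse,
    List.mem_finRange, true_and, List.mem_singleton]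
  refine ⟨?_, ⟨⟨?_, ?_, ?_⟩, by simp, ?_⟩⟩
  · rintro s ((⟨i, rfl⟩ | ⟨i, rfl⟩) | rfl) <;> simp [Fin.castSucc_ne_last]
  · refine hlt.imp fun {i j} hij => ?_
    simp [Fin.ext_iff]
    omega
  · refine hlt.imp fun {i j} hij => ?_
    simp [hij.ne']
  · rintro s ⟨i, rfl⟩ s' ⟨j, rfl⟩
    simp
  · rintro s (⟨i, rfl⟩ | ⟨i, rfl⟩) s' rfl <;> simp

theorem freshAmp_indexGates (σ : ℝ) (τ : Bool → ℝ) (x : Bits (Qubits r w m t u)) :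
    freshAmp (indexGates r w m t u σ τ) x =
      ((levelAmp w σ (fun i => x (.level i)) (fun i => x (.sign i)) * τ (x .scale) : ℝ) : ℂ) := by
  simp only [freshAmp, indexGates, levelAmp, List.map_append, List.map_cons, List.map_map,
    List.prod_append, List.prod_cons, List.map_reverse, List.prod_reverse, Function.comp_def,
    ← Fin.prod_univ_def, List.map_nil, List.prod_nil]
  push_cast
  ring

/-- The state of the index qubits after the preparation, for the index `k`. -/
noncomputable def indexState (r w : ℕ) (σ : ℝ) (τ : Bool → ℝ)
    (sign : (Fin (w + 1) → Bool) → (Fin w → Bool) → ℝ) (k : ℕ) (x : Bits (IndexQubits r w)) : ℂ :=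
  (∏ i : Fin r, fourierAmp k i (x (.inl i))) *
    ((levelAmp w σ (fun i => x (.inr (.inl i))) (fun i => x (.inr (.inr (.inl i)))) *
      sign (fun i => x (.inr (.inl i))) (fun i => x (.inr (.inr (.inl i)))) *
      τ (x (.inr (.inr (.inr ())))) : ℝ) : ℂ)

/-- The basis state with the index `k` in the index register, and `0` elsewhere. -/
def indexLabel (r w m t u k : ℕ) : Bits (Qubits r w m t u) :=
  Sum.elim (Sum.elim (encode r k) fun _ => false) fun _ => false

variable {p q N : ℕ} {Λ : Type} {e : Qubits r w m t u ≃ Fin N} {OA : Λ → QUnitary (Fin p)}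
  {OB : Λ → QUnitary (Fin q)}

/-- The signs are controlled-`Z` gates on the pairs `(c i, b i)`. They act before the Fourier
transform, so `setIndex` restores the original index in their arguments. -/
theorem prepares_indexState (k : Λ → ℕ) {σ : ℝ} (hσ : σ ^ 2 = 1) {τ : Bool → ℝ}
    (hτ : τ false ^ 2 + τ true ^ 2 = 1)
    (sign : ℕ → (Fin (w + 1) → Bool) → (Fin w → Bool) → ℝ)
    {ι : Type} [Fintype ι] (c b : ι → Qubits r w m t u)
    (hcb : ∀ i, c i ≠ b i)
    (hsign : ∀ (l : ℕ) (x : Bits (Qubits r w m t u)),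
      ∏ i, czSign (setIndex l x (c i)) (setIndex l x (b i)) = sign l (fun i => x (.level i)) fun i => x (.sign i)) :
    Prepares e OA OB (2 * w + 2 + Fintype.card ι + r * r) 0 0
      (fun l => Pi.single (indexLabel r w m t u (k l)) 1)
      (fun l x => if ∀ i, x (.inr i) = false then
        indexState r w σ τ (sign (k l)) (k l) (fun i => x (.inl i)) else 0) := by
  have hext : ∀ (l : ℕ) (x : Bits (Qubits r w m t u)),
      Function.extend Qubits.indexEmbedding (fun i : Fin r => l.testBit i) x =
        setIndex l x := by
    intro l x
    funext i
    rcases i with (i | i) | i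
    · exact Qubits.indexEmbedding.injective.extend_apply _ _ i
    · exact Function.extend_apply' _ _ _ (not_mem_range_index i)
    · exact Function.extend_apply' _ _ _ (inr_not_mem_range_index i)
  have h := prepares_fresh_phases_fourier (e := e) (OA := OA) (OB := OB) Qubits.indexEmbedding
    .scale (not_mem_range_index _) k (indexGates r w m t u σ τ) (indexGates_pairwise σ τ)
    (by
      intro s hs
      rcases mem_indexGates.1 hs with rfl | ⟨i, rfl⟩ | ⟨i, rfl⟩ | rfl <;> simp [Fin.ext_iff])
    (by
      intro s hs b
      rcases mem_indexGates.1 hs with rfl | ⟨i, rfl⟩ | ⟨i, rfl⟩ | rfl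
      · exact stepAmp_sq (one_pow 2) w true
      · exact stepAmp_sq hσ _ _
      · exact halfAmp_sq _
      · exact hτ)
    (by
      intro s hs
      rcases mem_indexGates.1 hs with rfl | ⟨i, rfl⟩ | ⟨i, rfl⟩ | rfl
      · exact ⟨inr_not_mem_range_index _, not_mem_range_index _⟩
      all_goals exact ⟨not_mem_range_index _, not_mem_range_index _⟩)
    (Finset.univ : Finset ι) c b (fun _ b b' => (czSign b b' : ℂ)) (fun i _ => hcb i)
    (by
      intro i _ b b'
      cases b <;> cases b' <;> simp [czSign])
  rw [indexGates_length, Finset.card_univ] at h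
  refine h.congr (fun l x => ?_) fun l x => ?_
  · rw [hext]
    rfl
  · have hiff : (∀ i ∉ Set.range Qubits.indexEmbedding,
        (∀ s ∈ indexGates r w m t u σ τ, i ≠ s.tgt) → x i = false) ↔
        ∀ i, x (.inr i) = false := by
      constructor
      · refine fun h i => h _ (inr_not_mem_range_index i) fun s hs => ?_
        rcases mem_indexGates.1 hs with rfl | ⟨i, rfl⟩ | ⟨i, rfl⟩ | rfl <;> simp
      · rintro h ((i | i | i | i) | i) h1 h2
        · exact absurd ⟨i, rfl⟩ h1
        · induction i using Fin.lastCases with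
          | last => exact absurd rfl (h2 _ (mem_indexGates.2 (.inl rfl)))
          | cast i => exact absurd rfl (h2 _ (mem_indexGates.2 (.inr (.inl ⟨i, rfl⟩))))
        · exact absurd rfl (h2 _ (mem_indexGates.2 (.inr (.inr (.inl ⟨i, rfl⟩)))))
        · exact absurd rfl (h2 _ (mem_indexGates.2 (.inr (.inr (.inr rfl)))))
        · exact h i
    simp only [hiff, hext]
    rw [← Complex.ofReal_prod, hsign, freshAmp_indexGates, indexState]
    split_ifs
    · rw [← Complex.ofReal_mul]
      congr 2
      ring
    · simp

/-- Here the normalization qubit stays `false`, so the inner product with a left state picks up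
exactly the factor `τ false`. -/
theorem prepares_right (hw : w ≤ r) (k : Λ → ℕ) :
    Prepares e OA OB (2 * w + 2 + w + r * r) 0 0
      (fun l => Pi.single (indexLabel r w m t u (k l)) 1)
      (fun l x => if ∀ i, x (.inr i) = false then
        indexState r w 1 (fun b => if b then 0 else 1) (fun _ h => rightSign w (k l) h) (k l)
          (fun i => x (.inl i)) else 0) := by
  have h := prepares_indexState (e := e) (OA := OA) (OB := OB) k (one_pow 2)
    (τ := fun b => if b then 0 else 1) (by simp) (fun l _ h => rightSign w l h)
    (fun i : Fin w => .sign i) (fun i => .index (Fin.castLE hw i)) (by simp)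
    (fun l x => rfl)
  rwa [Fintype.card_fin] at h

/-- The five gates per bit match the five factors of `leftSign`. -/
theorem prepares_left (hw : w ≤ r) (k : Λ → ℕ) {τ : Bool → ℝ}
    (hτ : τ false ^ 2 + τ true ^ 2 = 1) :
    Prepares e OA OB (2 * w + 2 + w * 5 + r * r) 0 0
      (fun l => Pi.single (indexLabel r w m t u (k l)) 1)
      (fun l x => if ∀ i, x (.inr i) = false then
        indexState r w (-1) τ (leftSign w (k l)) (k l) (fun i => x (.inl i)) else 0) := by
  have h := prepares_indexState (e := e) (OA := OA) (OB := OB) k (by norm_num : (-1 : ℝ) ^ 2 = 1)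
    hτ (fun l => leftSign w l)
    (fun a : Fin w × Fin 5 =>
      ![.sign a.1, .level a.1.succ, .level a.1.castSucc, .sign a.1, .sign a.1] a.2)
    (fun a => ![.index (Fin.castLE hw a.1), .index (Fin.castLE hw a.1),
      .index (Fin.castLE hw a.1), .level a.1.succ, .level a.1.castSucc] a.2)
    (by
      rintro ⟨i, j⟩
      fin_cases j <;> simp)
    (by
      intro l x
      rw [Fintype.prod_prod_type]
      refine Finset.prod_congr rfl fun i _ => ?_
      rw [Fin.prod_univ_five]
      rfl)
  rwa [Fintype.card_prod, Fintype.card_fin, Fintype.card_fin] at h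

end Layout

theorem encode_zero (w : ℕ) : encode w 0 = fun _ => false := by
  funext i
  simp [encode]

theorem encode_ofBits {w : ℕ} (b : Fin w → Bool) : encode w (Nat.ofBits b) = b := by
  funext i
  simp [encode, Nat.testBit_ofBits_lt]

theorem sum_bits_sum {α β M : Type} [Fintype α] [Fintype β] [DecidableEq α] [DecidableEq β]
    [AddCommMonoid M] (f : Bits (α ⊕ β) → M) :
    ∑ x, f x = ∑ a : Bits α, ∑ b : Bits β, f (Sum.elim a b) := by
  rw [← Fintype.sum_prod_type' fun a b => f (Sum.elim a b)]
  exact Fintype.sum_equiv (Equiv.sumArrowEquivProdArrow α β Bool) _ _ fun x => by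
    congr 1
    exact (Sum.elim_comp_inl_inr x).symm

/-! ### Oracle queries and the threshold register -/

section Value

variable {r w m t u : ℕ}

/-- The number of the sample point in the index register after the Fourier transform. -/
def sampleIndex (x : Bits (IndexQubits r w)) : ℕ := Nat.ofBits fun j => x (.inl (Fin.rev j))

theorem sampleIndex_lt (x : Bits (IndexQubits r w)) : sampleIndex x < 2 ^ r :=
  Nat.ofBits_lt_two_pow _

/-- The contents of the value qubits, with `a` and `b` in the output registers. -/
def valueLabel (m t u : ℕ) (a b : ℕ) : Bits (Fin m ⊕ (Fin t ⊕ Fin u)) :=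
  Sum.elim (fun _ => false) (Sum.elim (encode t a) (encode u b))

/-- The gates that prepare the threshold register. -/
noncomputable def thresholdGates (r w m t u : ℕ) : List (FreshGate (Qubits r w m t u)) :=
  ⟨.scale, .threshold (Fin.last t), fun _ => halfAmp true⟩ ::
    (List.finRange t).reverse.map fun i => ⟨.threshold i.succ, .threshold i.castSucc, halfAmp⟩

theorem mem_thresholdGates {s : FreshGate (Qubits r w m t u)} :
    s ∈ thresholdGates r w m t u ↔
      s = ⟨.scale, .threshold (Fin.last t), fun _ => halfAmp true⟩ ∨
      ∃ i : Fin t, s = ⟨.threshold i.succ, .threshold i.castSucc, halfAmp⟩ := by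
  simp only [thresholdGates, List.mem_cons, List.mem_map, List.mem_reverse, List.mem_finRange,
    true_and, eq_comm (b := s)]

theorem thresholdGates_pairwise :
    (thresholdGates r w m t u).Pairwise fun s s' => s'.tgt ≠ s.tgt ∧ s'.tgt ≠ s.ctrl := by
  simp only [thresholdGates, List.pairwise_cons, List.pairwise_map, List.pairwise_reverse,
    List.mem_map, List.mem_reverse, List.mem_finRange, true_and]
  refine ⟨?_, (List.pairwise_lt_finRange t).imp fun {i j} hij => ?_⟩
  · rintro s ⟨i, rfl⟩
    simp [Fin.castSucc_ne_last]
  · simp [Fin.ext_iff]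
    omega

theorem freshAmp_thresholdGates (x : Bits (Qubits r w m t u)) :
    freshAmp (thresholdGates r w m t u) x =
      (thresholdAmp t (fun i => x (.threshold i)) : ℂ) := by
  simp only [freshAmp, thresholdGates, thresholdAmp, List.map_cons, List.map_map,
    List.prod_cons, List.map_reverse, List.prod_reverse, Function.comp_def, ← Fin.prod_univ_def]
  push_cast
  rfl

/-- The state `ψ` of the index qubits, together with the values `fA` and `fB` at the sample point
in the output registers, and the prepared threshold register. -/
noncomputable def valueState (m t u : ℕ) (fA fB : ℕ → ℕ) (ψ : Bits (IndexQubits r w) → ℂ)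
    (x : Bits (Qubits r w m t u)) : ℂ :=
  if (fun i => x (.inr (.inr i))) = valueLabel m t u (fA (sampleIndex fun i => x (.inl i)))
      (fB (sampleIndex fun i => x (.inl i))) then
    ψ (fun i => x (.inl i)) * thresholdAmp t (fun i => x (.threshold i)) else 0

end Value

section Query

variable {w n nIn dA dB : ℕ}

/-- The qubits on which an oracle with the output qubits `o` acts. -/
def queryQubits {r m t u d : ℕ} (o : Fin d ↪ Fin t ⊕ Fin u) : Fin (m + r + d) ↪ Qubits r w m t u where
  toFun := Fin.append (Fin.append (fun i => .inr (.inr (.inl i))) fun i => .index i.rev)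
    fun i => .inr (.inr (.inr (o i)))
  inj' := by
    rw [Fin.append_injective_iff, Fin.append_injective_iff]
    refine ⟨⟨fun i j h => by simpa using h, fun i j h => by simpa using h, by simp⟩,
      fun i j h => o.injective (by simpa using h), fun i j => ?_⟩
    refine Fin.addCases (fun i => ?_) (fun i => ?_) i <;> simp

theorem comp_queryQubits {r m t u d : ℕ} (o : Fin d ↪ Fin t ⊕ Fin u)
    (x : Bits (Qubits r w m t u)) :
    (fun j => x (queryQubits o j)) = Fin.append (Fin.append (fun i => x (.inr (.inr (.inl i))))
      fun i => x (.index i.rev)) fun i => x (.inr (.inr (.inr (o i)))) := by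
  funext j
  refine Fin.addCases (fun j => ?_) (fun j => ?_) j
  · refine Fin.addCases (fun j => ?_) (fun j => ?_) j <;> simp [queryQubits]
  · simp [queryQubits]

theorem mem_range_queryQubits {r m t u d : ℕ} (o : Fin d ↪ Fin t ⊕ Fin u) (i : Fin d) :
    (.inr (.inr (.inr (o i))) : Qubits r w m t u) ∈ Set.range (queryQubits o) :=
  ⟨Fin.natAdd _ i, by simp [queryQubits]⟩

/-- The qubits on which an oracle with the output qubits `o` acts, for the given registers. -/
def queryEmbedding {d : ℕ} (o : Fin (width d) ↪ Fin (width dA) ⊕ Fin (width dB)) :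
    Fin (oracleWidth n nIn d) ↪ Qubits (width nIn) w (width (2 * n)) (width dA) (width dB) :=
  queryQubits o

theorem comp_queryEmbedding {d v : ℕ} (o : Fin (width d) ↪ Fin (width dA) ⊕ Fin (width dB))
    (x : Bits (Qubits (width nIn) w (width (2 * n)) (width dA) (width dB)))
    (hx : ∀ i, x (.inr (.inr (.inl i))) = false)
    (hv : ∀ i, x (.inr (.inr (.inr (o i)))) = encode (width d) v i) :
    (fun j => x (queryEmbedding o j)) =
      oracleLabel n nIn d 0 (sampleIndex fun i => x (.inl i)) v := by
  refine (comp_queryQubits o x).trans ?_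
  simp only [hx, hv, oracleLabel, sampleIndex, encode_zero, encode_ofBits]

theorem mem_range_queryEmbedding {d : ℕ} (o : Fin (width d) ↪ Fin (width dA) ⊕ Fin (width dB))
    (i : Fin (width d)) : (.inr (.inr (.inr (o i))) :
      Qubits (width nIn) w (width (2 * n)) (width dA) (width dB)) ∈
        Set.range (queryEmbedding (n := n) o) :=
  mem_range_queryQubits o i

variable {N : ℕ} {Λ : Type}
  {e : Qubits (width nIn) w (width (2 * n)) (width dA) (width dB) ≃ Fin N}
  {OA : Λ → QUnitary (Fin (oracleWidth n nIn dA))}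
  {OB : Λ → QUnitary (Fin (oracleWidth n nIn dB))}

/-- The steps are checked on basis states of the index qubits and extended linearly by
`Prepares.sum`. Since `nIn` is a power of two, every content of the index register is a legitimate
`s`; the `m` register stays at `0`. -/
theorem prepares_valueState (hn : 1 ≤ n) (hIn : nIn = 2 ^ width nIn) {fA fB : Λ → ℕ → ℕ → ℕ}
    (hA : ∀ l, IsOracle n nIn dA (fA l) (OA l)) (hB : ∀ l, IsOracle n nIn dB (fB l) (OB l))
    (ψ : Λ → Bits (IndexQubits (width nIn) w) → ℂ) :
    Prepares e OA OB (width dA + 1) 1 1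
      (fun l x => if ∀ i, x (.inr i) = false then ψ l (fun i => x (.inl i)) else 0)
      (fun l => valueState (width (2 * n)) (width dA) (width dB) (fA l 0) (fB l 0) (ψ l)) := by
  classical
  let y₀ : Λ × Bits (IndexQubits (width nIn) w) →
      Bits (Qubits (width nIn) w (width (2 * n)) (width dA) (width dB)) :=
    fun l => Sum.elim l.2 fun _ => false
  let y₁ : Λ × Bits (IndexQubits (width nIn) w) →
      Bits (Qubits (width nIn) w (width (2 * n)) (width dA) (width dB)) :=
    fun l => Sum.elim l.2 (Sum.elim (fun _ => false)
      (valueLabel _ _ _ (fA l.1 0 (sampleIndex l.2)) 0))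
  let y₂ : Λ × Bits (IndexQubits (width nIn) w) →
      Bits (Qubits (width nIn) w (width (2 * n)) (width dA) (width dB)) :=
    fun l => Sum.elim l.2 (Sum.elim (fun _ => false)
      (valueLabel _ _ _ (fA l.1 0 (sampleIndex l.2)) (fB l.1 0 (sampleIndex l.2))))
  have hs : ∀ x : Bits (IndexQubits (width nIn) w), sampleIndex x < nIn :=
    fun x => (sampleIndex_lt x).trans_eq hIn.symm
  have h1 := prepares_queryAbs (e := e) (OA := fun l : Λ × Bits (IndexQubits (width nIn) w) =>
      OA l.1) (OB := fun l => OB l.1) (queryEmbedding ⟨Sum.inl, Sum.inl_injective⟩) y₀ y₁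
    (by
      intro l
      rw [comp_queryEmbedding (d := dA) (v := 0) _ (y₀ l) (fun _ => rfl)
        (fun i => by rw [encode_zero]; rfl),
        comp_queryEmbedding (d := dA) (v := fA l.1 0 (sampleIndex l.2)) _ (y₁ l) (fun _ => rfl)
        (fun _ => rfl)]
      exact hA l.1 0 (by omega) (sampleIndex l.2) (hs l.2))
    (by
      rintro l (i | i | i | i | i) hi
      · rfl
      · rfl
      · rfl
      · exact absurd (mem_range_queryEmbedding _ i) hi
      · simp [y₀, y₁, valueLabel, encode_zero])
  have h2 := h1.trans (prepares_queryArg (queryEmbedding ⟨Sum.inr, Sum.inr_injective⟩) y₁ y₂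
    (by
      intro l
      rw [comp_queryEmbedding (d := dB) (v := 0) _ (y₁ l) (fun _ => rfl)
        (fun _ => rfl),
        comp_queryEmbedding (d := dB) (v := fB l.1 0 (sampleIndex l.2)) _ (y₂ l) (fun _ => rfl)
        (fun _ => rfl)]
      exact hB l.1 0 (by omega) (sampleIndex l.2) (hs l.2))
    (by
      rintro l (i | i | i | i | i) hi
      · rfl
      · rfl
      · rfl
      · rfl
      · exact absurd (mem_range_queryEmbedding _ i) hi))
  have h3 := h2.trans (prepares_fresh (thresholdGates _ _ _ _ _) thresholdGates_pairwise
    (by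
      intro s hs
      rcases mem_thresholdGates.1 hs with rfl | ⟨i, rfl⟩ <;> simp [Fin.ext_iff])
    (by
      intro s hs b
      rcases mem_thresholdGates.1 hs with rfl | ⟨i, rfl⟩
      · exact halfAmp_sq true
      · exact halfAmp_sq b)
    y₂
    (by
      intro l s hs
      rcases mem_thresholdGates.1 hs with rfl | ⟨i, rfl⟩ <;> rfl))
  refine ((h3.sum ψ).congr (fun l x => ?_) fun l x => ?_).mono ?_ le_rfl le_rfl
  · have hiff : ∀ x₁, x = y₀ (l, x₁) ↔ x₁ = (fun i => x (.inl i)) ∧ ∀ i, x (.inr i) = false := by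
      intro x₁
      constructor
      · rintro rfl
        exact ⟨rfl, fun _ => rfl⟩
      · rintro ⟨rfl, h⟩
        funext i
        rcases i with i | i
        · rfl
        · exact h i
    simp only [Pi.single_apply, hiff]
    rw [Finset.sum_eq_single fun i => x (.inl i)]
    · simp
    · intro x₁ _ h
      simp [h]
    · simp
  · have hiff : ∀ x₁, (∀ i, (∀ s ∈ thresholdGates (width nIn) w (width (2 * n)) (width dA)
        (width dB), i ≠ s.tgt) → x i = y₂ (l, x₁) i) ↔
        x₁ = (fun i => x (.inl i)) ∧ (fun i => x (.inr (.inr i))) =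
          valueLabel _ _ _ (fA l 0 (sampleIndex x₁)) (fB l 0 (sampleIndex x₁)) := by
      intro x₁
      constructor
      · intro h
        refine ⟨funext fun i => (h (.inl i) fun s hs => ?_).symm,
          funext fun i => h (.inr (.inr i)) fun s hs => ?_⟩
        all_goals rcases mem_thresholdGates.1 hs with rfl | ⟨i, rfl⟩ <;> simp
      · rintro ⟨rfl, h⟩ (i | i | i) hi
        · rfl
        · induction i using Fin.lastCases with
          | last => exact absurd rfl (hi _ (mem_thresholdGates.2 (.inl rfl)))
          | cast i => exact absurd rfl (hi _ (mem_thresholdGates.2 (.inr ⟨i, rfl⟩)))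
        · exact congrFun h i
    simp only [hiff, valueState]
    rw [Finset.sum_eq_single fun i => x (.inl i)]
    · rw [freshAmp_thresholdGates]
      simp
    · intro x₁ _ h
      simp [h]
    · simp
  · simp [thresholdGates]

end Query

set_option synthInstance.maxSize 1000

/-! ### From oracle values to a diagonal multiplier -/

section Phases

variable {r w m t u p q N : ℕ} {Λ : Type} {e : Qubits r w m t u ≃ Fin N}
  {OA : Λ → QUnitary (Fin p)} {OB : Λ → QUnitary (Fin q)}

/-- The phase given to a basis state with the value `a` in the first output register and `b` in
the second one. -/
noncomputable def valuePhase (t u a b : ℕ) (x : Fin (t + 1) → Bool) : ℂ :=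
  thresholdSign t a x * Complex.exp (2 * Real.pi * Complex.I / 2 ^ u * b)

theorem prepares_valuePhase {fA fB : Λ → ℕ → ℕ} (hB : ∀ l s, s < 2 ^ r → fB l s < 2 ^ u)
    (ψ : Λ → Bits (IndexQubits r w) → ℂ) :
    Prepares e OA OB (2 * t + 1 + u) 0 0
      (fun l => valueState m t u (fA l) (fB l) (ψ l))
      (fun l x => valuePhase t u (fA l (sampleIndex fun i => x (.inl i)))
        (fB l (sampleIndex fun i => x (.inl i))) (fun i => x (.threshold i)) *
          valueState m t u (fA l) (fB l) (ψ l) x) := by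
  have h1 := prepares_phases (e := e) (OA := OA) (OB := OB) (Finset.univ : Finset (Fin t ⊕ Fin t))
    (Sum.elim (fun i => .outAbs i) fun i => .outAbs i)
    (Sum.elim (fun i => .threshold i.succ) fun i => .threshold i.castSucc)
    (fun _ b b' => (czSign b b' : ℂ)) (by rintro (i | i) _ <;> simp)
    (by
      intro i _ b b'
      cases b <;> cases b' <;> simp [czSign])
    (fun l => valueState m t u (fA l) (fB l) (ψ l))
  -- A one-qubit `Z` on the top threshold qubit, and below one-qubit phases on the argument
  -- register; `.scale` is only an idle partner.
  have h2 := h1.trans (prepares_phases (Finset.univ : Finset Unit) (fun _ => .scale)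
    (fun _ => .threshold (Fin.last t)) (fun _ _ b => (czSign b b : ℂ)) (by simp)
    (by
      intro i _ _ b
      cases b <;> simp [czSign]) _)
  have h3 := h2.trans (prepares_phases (Finset.univ : Finset (Fin u)) (fun _ => .scale)
    (fun i => .outArg i) (fun i _ b => if b then
      Complex.exp (2 * Real.pi * Complex.I / 2 ^ u * 2 ^ (i : ℕ)) else 1) (by simp)
    (by
      intro i _ _ b
      split_ifs
      · rw [show (2 * Real.pi * Complex.I / 2 ^ u * 2 ^ (i : ℕ) : ℂ) =
          ((2 * Real.pi / 2 ^ u * 2 ^ (i : ℕ) : ℝ) : ℂ) * Complex.I by push_cast; ring,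
          Complex.norm_exp_ofReal_mul_I]
      · simp) _)
  refine (h3.congr (fun _ _ => rfl) fun l x => ?_).mono ?_ le_rfl le_rfl
  · by_cases hx : (fun i => x (.inr (.inr i))) =
        valueLabel m t u (fA l (sampleIndex fun i => x (.inl i)))
          (fB l (sampleIndex fun i => x (.inl i)))
    · have hA : ∀ i : Fin t, x (.outAbs i) =
          (fA l (sampleIndex fun i => x (.inl i))).testBit i := fun i => congrFun hx (.inr (.inl i))
      have hB' : ∀ i : Fin u, x (.outArg i) =
          (fB l (sampleIndex fun i => x (.inl i))).testBit i := fun i => congrFun hx (.inr (.inr i))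
      have hexp := prod_exp_testBit (2 * Real.pi * Complex.I / 2 ^ u)
        (fB l (sampleIndex fun i => x (.inl i))) u
      rw [Finset.prod_range, Nat.mod_eq_of_lt (hB _ _ (sampleIndex_lt _))] at hexp
      simp only [valuePhase, thresholdSign, ← hexp, ← hA, ← hB', Fintype.prod_sum_type,
        Sum.elim_inl, Sum.elim_inr, Finset.univ_unique, Finset.prod_singleton,
        Finset.prod_mul_distrib]
      push_cast
      ring
    · simp [valueState, hx]
  · simp [two_mul]

/-- Both states carry the same oracle outputs and threshold register, so nothing has to be
uncomputed: the inner product is diagonal in the index qubits, and summing over the threshold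
register turns signs into `v / 2^t`. -/
theorem valueState_dotProduct {fA fB : ℕ → ℕ} (hA : ∀ s < 2 ^ r, fA s < 2 ^ t)
    (φ ψ : Bits (IndexQubits r w) → ℂ) :
    (star (valueState m t u fA fB φ) ⬝ᵥ fun x : Bits (Qubits r w m t u) =>
      valuePhase t u (fA (sampleIndex fun i => x (.inl i)))
        (fB (sampleIndex fun i => x (.inl i))) (fun i => x (.threshold i)) *
          valueState m t u fA fB ψ x) =
    ∑ x, star (φ x) * (((fA (sampleIndex x) / 2 ^ t : ℝ) : ℂ) *
      Complex.exp (2 * Real.pi * Complex.I / 2 ^ u * fB (sampleIndex x)) * ψ x) := by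
  simp only [dotProduct, sum_bits_sum (β := ValueQubits m t u),
    sum_bits_sum (α := Fin (t + 1)), Pi.star_apply, valueState, Sum.elim_inl, Sum.elim_inr]
  refine Finset.sum_congr rfl fun x _ => ?_
  rw [← sum_thresholdAmp (hA _ (sampleIndex_lt x))]
  push_cast
  simp only [Finset.sum_mul, Finset.mul_sum]
  refine Finset.sum_congr rfl fun y _ => ?_
  rw [Finset.sum_eq_single (valueLabel m t u (fA (sampleIndex x)) (fB (sampleIndex x)))]
  · simp [valuePhase]
    ring
  · intro z _ hz
    exact mul_eq_zero_of_left ((congrArg star (if_neg hz)).trans (star_zero _)) _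
  · simp

end Phases

/-! ### Inner products and orthonormality of the index states -/

section IndexSum

theorem sum_ofBits_rev {r : ℕ} (F : ℕ → ℂ) :
    ∑ b : Fin r → Bool, F (Nat.ofBits fun j => b j.rev) = ∑ s ∈ Finset.range (2 ^ r), F s := by
  refine Finset.sum_nbij' (fun b => Nat.ofBits fun j => b j.rev)
    (fun s i => encode r s i.rev) ?_ (by simp) ?_ ?_ (by simp)
  · intro b _
    exact Finset.mem_range.2 (Nat.ofBits_lt_two_pow _)
  · intro b _
    simp [encode_ofBits]
  · intro s hs
    simp only [Fin.rev_rev]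
    exact (Nat.ofBits_testBit s r).trans (Nat.mod_eq_of_lt (Finset.mem_range.1 hs))

/-- The amplitudes factor over the registers: the Fourier phases combine to `e^{i(k-l)x_s}`, the
level and sign registers give the truncation, and the normalization qubit gives `τ false`. -/
theorem sum_indexState {r w k l : ℕ} (hwr : w ≤ r) (hk : k < 2 ^ w) (hl : l < 2 ^ w)
    (τ : Bool → ℝ) (F : ℕ → ℂ) :
    ∑ x, star (indexState r w (-1) τ (leftSign w k) k x) * (F (sampleIndex x) *
      indexState r w 1 (fun b => if b then 0 else 1) (fun _ h => rightSign w l h) l x) =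
    ((τ false * if l ≤ k then 2 / ((w : ℝ) + 2) else 0 : ℝ) : ℂ) *
      (1 / 2 ^ r * ∑ s ∈ Finset.range (2 ^ r), F s *
        Complex.exp (Complex.I * (k - l) * (Real.pi - 2 * Real.pi / 2 ^ r * s : ℝ))) := by
  have hpow : (2 : ℕ) ^ w ≤ 2 ^ r := Nat.pow_le_pow_right (by norm_num) hwr
  rw [sum_bits_sum (M := ℂ)]
  simp only [sum_bits_sum (α := Fin (w + 1)) (M := ℂ),
    sum_bits_sum (α := Fin w) (β := Unit) (M := ℂ), indexState,
    sampleIndex, Sum.elim_inl, Sum.elim_inr, prod_fourierAmp (hk.trans_le hpow),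
    prod_fourierAmp (hl.trans_le hpow)]
  rw [← sum_ofBits_rev, Finset.mul_sum, Finset.mul_sum]
  refine Finset.sum_congr rfl fun b _ => ?_
  rw [← sum_levelAmp hk hl]
  push_cast
  simp only [Finset.mul_sum, Finset.sum_mul]
  refine Finset.sum_congr rfl fun y _ => Finset.sum_congr rfl fun h _ => ?_
  rw [← (Equiv.funUnique Unit Bool).symm.sum_comp]
  have h2 : (Real.sqrt 2 : ℂ)⁻¹ ^ r * (Real.sqrt 2 : ℂ)⁻¹ ^ r = 1 / 2 ^ r := by
    rw [← mul_pow, ← mul_inv, ← Complex.ofReal_mul,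
      Real.mul_self_sqrt (by norm_num)]
    simp
  have h3 : ∀ x : ℂ, (starRingEnd ℂ) x = x →
      (starRingEnd ℂ) (Complex.exp (-(Complex.I * k * x))) *
      Complex.exp (-(Complex.I * l * x)) = Complex.exp (Complex.I * (k - l) * x) := by
    intro x hx
    rw [← Complex.exp_conj, ← Complex.exp_add]
    congr 1
    simp only [map_neg, map_mul, Complex.conj_I, hx, map_natCast]
    ring
  rw [← h3 _ (by simp [Complex.conj_ofNat]), ← h2]
  simp [RCLike.star_def]
  ring

/-- The states are images of distinct basis states under one unitary circuit, here instantiated with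
trivial oracles and minimal value registers. -/
theorem indexState_orthonormal {r w : ℕ} {σ : ℝ} {τ : Bool → ℝ}
    {sign : ℕ → (Fin (w + 1) → Bool) → (Fin w → Bool) → ℝ} {g : ℕ}
    (h : ∀ k : ℕ → ℕ, Prepares (p := 0) (q := 0) (Fintype.equivFin (Qubits r w 0 0 0))
      (fun _ => 1) (fun _ => 1) g 0 0
      (fun l => Pi.single (indexLabel r w 0 0 0 (k l)) 1)
      (fun l x => if ∀ i, x (.inr i) = false then
        indexState r w σ τ (sign (k l)) (k l) (fun i => x (.inl i)) else 0))
    {k l : ℕ} (hk : k < 2 ^ r) (hl : l < 2 ^ r) :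
    ∑ x, star (indexState r w σ τ (sign k) k x) * indexState r w σ τ (sign l) l x =
      if k = l then 1 else 0 := by
  have h' := (h id).dotProduct_eq (l := k) (l' := l) rfl rfl
  have hinj : indexLabel r w 0 0 0 k = indexLabel r w 0 0 0 l ↔ k = l := by
    refine ⟨fun h => ?_, fun h => by rw [h]⟩
    have : encode r k = encode r l := funext fun i => congrFun h (.inl (.inl i))
    have h1 : Nat.ofBits (fun i : Fin r => k.testBit i) = Nat.ofBits fun i : Fin r => l.testBit i :=
      congrArg Nat.ofBits this
    rwa [Nat.ofBits_testBit, Nat.ofBits_testBit, Nat.mod_eq_of_lt hk, Nat.mod_eq_of_lt hl] at h1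
  simp only [id, dotProduct, Pi.star_apply] at h'
  rw [sum_bits_sum] at h'
  simp only [Sum.elim_inr, Sum.elim_inl] at h'
  have hz : ∀ (x : Bits (IndexQubits r w)) , (∑ y : Bits (ValueQubits 0 0 0),
      star (if ∀ i, y i = false then indexState r w σ τ (sign k) k (fun i => x i) else 0) *
      (if ∀ i, y i = false then indexState r w σ τ (sign l) l (fun i => x i) else 0)) =
      star (indexState r w σ τ (sign k) k x) * indexState r w σ τ (sign l) l x := by
    intro x
    rw [Finset.sum_eq_single fun _ => false]
    · simp
    · intro y _ hy
      rw [if_neg fun h => hy (funext h), if_neg fun h => hy (funext h)]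
      simp
    · simp
  rw [(Finset.sum_congr rfl fun x _ => (hz x).symm).trans h']
  simp only [Pi.single_apply]
  rw [Finset.sum_eq_single (indexLabel r w 0 0 0 k)]
  · simp [hinj]
  · intro y _ hy
    simp [hy]
  · simp

end IndexSum

/-! ### The complete circuit -/

section Assembly

/-- The system is the low `w` qubits of the index register. The other index qubits vanish for `k < 2
^ w` and count as ancillas. -/
theorem exists_qubits_equiv {r w : ℕ} (m t u : ℕ) (hwr : w ≤ r) :
    ∃ (a : ℕ) (e : Qubits r w m t u ≃ Fin (w + a)), ∀ k < 2 ^ w,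
      pull e (Pi.single (indexLabel r w m t u k) 1) =
        Pi.single (Fin.append (encode w k) fun _ : Fin a => false) 1 := by
  obtain ⟨r', rfl⟩ := Nat.exists_eq_add_of_le hwr
  let R := (Fin (w + 1) ⊕ (Fin w ⊕ Unit)) ⊕ ValueQubits m t u
  let f : Qubits (w + r') w m t u ≃ Fin w ⊕ (Fin r' ⊕ R) :=
    ((Equiv.sumAssoc _ _ _).trans (Equiv.sumCongr finSumFinEquiv.symm (Equiv.refl R))).trans
      (Equiv.sumAssoc _ _ _)
  refine ⟨Fintype.card (Fin r' ⊕ R), f.trans ((Equiv.sumCongr (Equiv.refl _)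
    (Fintype.equivFin _)).trans finSumFinEquiv), fun k hk => ?_⟩
  rw [pull_single]
  congr 1
  funext i
  refine Fin.addCases (fun i => ?_) (fun i => ?_) i
  · simp [f, indexLabel, encode]
  · simp only [Equiv.symm_trans_apply, finSumFinEquiv_symm_apply_natAdd, Equiv.sumCongr_symm,
      Equiv.sumCongr_apply, Sum.map_inr, Fin.append_right]
    rcases (Fintype.equivFin (Fin r' ⊕ R)).symm i with j | (j | j)
    · simp only [f, Equiv.symm_trans_apply, Equiv.sumAssoc_symm_apply_inr_inl,
        Equiv.sumCongr_symm, Equiv.sumCongr_apply, Sum.map_inl, Equiv.symm_symm,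
        finSumFinEquiv_apply_right, Equiv.sumAssoc_symm_apply_inl, indexLabel, Sum.elim_inl, encode]
      exact Nat.testBit_eq_false_of_lt (hk.trans_le (Nat.pow_le_pow_right (by norm_num) (by simp)))
    · rfl
    · rfl

theorem exists_circuit {n nIn dA dB : ℕ} (hn : 1 ≤ n) (hIn : nIn = 2 ^ width nIn)
    (hw : width n ≤ width nIn) {τ : Bool → ℝ} (hτ : τ false ^ 2 + τ true ^ 2 = 1) :
    ∃ (a : ℕ) (c : Circuit (oracleWidth n nIn dA) (oracleWidth n nIn dB) (width n + a)),
      c.absQueries ≤ 2 ∧ c.argQueries ≤ 2 ∧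
      c.twoQubitGates ≤
        (2 * width nIn * width nIn + 10 * width nIn + 4 * width dA + width dB + 7) ∧
      ∀ (OA : QUnitary (Fin (oracleWidth n nIn dA))) (OB : QUnitary (Fin (oracleWidth n nIn dB)))
        (fA fB : ℕ → ℕ → ℕ), IsOracle n nIn dA fA OA → IsOracle n nIn dB fB OB →
        (∀ s < 2 ^ width nIn, fA 0 s < 2 ^ width dA) →
        (∀ s < 2 ^ width nIn, fB 0 s < 2 ^ width dB) → ∀ k l : Fin n,
        ((ancillaZero n a)ᴴ * c.toMatrix OA OB * ancillaZero n a) k l =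
          ∑ x, star (indexState (width nIn) (width n) (-1) τ (leftSign (width n) k) k x) *
            (((fA 0 (sampleIndex x) / 2 ^ width dA : ℝ) : ℂ) *
              Complex.exp (2 * Real.pi * Complex.I / 2 ^ width dB * fB 0 (sampleIndex x)) *
            indexState (width nIn) (width n) 1 (fun b => if b then 0 else 1)
              (fun _ h => rightSign (width n) l h) l x) := by
  obtain ⟨a, e, he⟩ := exists_qubits_equiv (width (2 * n)) (width dA) (width dB) hw
  -- `Prepares` quantifies over all labels, so the label bundles the oracles with the validity of
  -- their outputs; this makes one circuit serve all oracles.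
  let Λ := {O : QUnitary (Fin (oracleWidth n nIn dA)) × QUnitary (Fin (oracleWidth n nIn dB)) ×
    (ℕ → ℕ → ℕ) × (ℕ → ℕ → ℕ) // IsOracle n nIn dA O.2.2.1 O.1 ∧ IsOracle n nIn dB O.2.2.2 O.2.1 ∧
      (∀ s < 2 ^ width nIn, O.2.2.1 0 s < 2 ^ width dA) ∧
      ∀ s < 2 ^ width nIn, O.2.2.2 0 s < 2 ^ width dB}
  let k : Λ × Fin n → ℕ := fun l => l.2
  have hL := (prepares_left (e := e) (OA := fun l : Λ × Fin n => l.1.1.1)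
    (OB := fun l => l.1.1.2.1) hw k hτ).trans (prepares_valueState hn hIn
      (fun l => l.1.2.1) (fun l => l.1.2.2.1) _)
  have hR := ((prepares_right (e := e) (OA := fun l : Λ × Fin n => l.1.1.1)
    (OB := fun l => l.1.1.2.1) hw k).trans (prepares_valueState hn hIn
      (fun l => l.1.2.1) (fun l => l.1.2.2.1) _)).trans
      (prepares_valuePhase (fun l => l.1.2.2.2.2) _)
  obtain ⟨c, h1, h2, h3, h4⟩ := Prepares.block (OA := fun l : Λ => l.1.1)
    (OB := fun l => l.1.2.1) hL hR
  refine ⟨a, c, h2, h3, h1.trans ?_, fun OA OB fA fB hA hB hA' hB' i j => ?_⟩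
  -- With `t`, `u` the output widths, the left part has `7w + 2 + r² + (t + 1)` gates and the right
  -- part `3w + 2 + r² + (t + 1) + (2t + 1 + u)`; then `w ≤ r`.
  · nlinarith
  · have h5 := h4 ⟨(OA, OB, fA, fB), hA, hB, hA', hB'⟩ i j
    have hi : ∀ i : Fin n, (i : ℕ) < 2 ^ width n := fun i =>
      i.2.trans_le (Nat.le_pow_clog (by norm_num) n)
    have hcol : ∀ i : Fin n, (fun x => ancillaZero n a x i) =
        pull e (Pi.single (indexLabel (width nIn) (width n) (width (2 * n)) (width dA)
          (width dB) i) 1) := by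
      intro i
      rw [he _ (hi i)]
      funext x
      simp [ancillaZero, Pi.single_apply]
    rw [← valueState_dotProduct (m := width (2 * n)) hA', ← h5]
    simp only [k, ← hcol]
    simp only [Matrix.mul_apply, dotProduct, Matrix.mulVec, Matrix.conjTranspose_apply,
      Finset.sum_mul, Finset.mul_sum, Pi.star_apply, mul_assoc]
    exact Finset.sum_comm

end Assembly

/-! ### Spectral norm bounds and Toeplitz entries -/

section Norms

open scoped Matrix.Norms.L2Operator in
-- The matrix is `Φᴴ D Ψ` with isometries `Φ`, `Ψ` and diagonal `D`, so its norm is at most `sup ‖D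
-- x‖`, independently of `n`.
theorem norm_toEuclideanCLM_le_of_orthonormal {X : Type} [Fintype X] [DecidableEq X] {n : ℕ}
    {φ ψ : Fin n → X → ℂ} (hφ : ∀ k l, ∑ x, star (φ k x) * φ l x = if k = l then 1 else 0)
    (hψ : ∀ k l, ∑ x, star (ψ k x) * ψ l x = if k = l then 1 else 0)
    {D : X → ℂ} {δ : ℝ} (hδ : 0 ≤ δ) (hD : ∀ x, ‖D x‖ ≤ δ) :
    ‖Matrix.toEuclideanCLM (n := Fin n) (𝕜 := ℂ)
      (Matrix.of fun k l => ∑ x, star (φ k x) * (D x * ψ l x))‖ ≤ δ := by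
  have hone : ‖(1 : Matrix (Fin n) (Fin n) ℂ)‖ ≤ 1 := by
    rw [← Matrix.diagonal_one, Matrix.l2_opNorm_diagonal]
    exact (pi_norm_le_iff_of_nonneg zero_le_one).2 fun _ => by simp
  have hiso : ∀ η : Fin n → X → ℂ, (∀ k l, ∑ x, star (η k x) * η l x = if k = l then 1 else 0) →
      ‖(Matrix.of fun x k => η k x : Matrix X (Fin n) ℂ)‖ ≤ 1 := by
    intro η hη
    have h : (Matrix.of fun x k => η k x : Matrix X (Fin n) ℂ)ᴴ *
        (Matrix.of fun x k => η k x) = 1 := by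
      ext k l
      simp only [Matrix.mul_apply, Matrix.conjTranspose_apply, Matrix.of_apply, hη,
        Matrix.one_apply]
    have h' := Matrix.l2_opNorm_conjTranspose_mul_self (Matrix.of fun x k => η k x)
    rw [h] at h'
    nlinarith [norm_nonneg (Matrix.of fun x k => η k x : Matrix X (Fin n) ℂ)]
  have hmat : (Matrix.of fun k l => ∑ x, star (φ k x) * (D x * ψ l x)) =
      (Matrix.of fun x k => φ k x)ᴴ * (Matrix.diagonal D * Matrix.of fun x k => ψ k x) := by
    ext k l
    simp [Matrix.mul_apply, Matrix.diagonal_apply]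
  rw [← Matrix.cstar_norm_def, hmat]
  refine (Matrix.l2_opNorm_mul _ _).trans ?_
  rw [Matrix.l2_opNorm_conjTranspose]
  have hdiag : ‖Matrix.diagonal D‖ ≤ δ := by
    rw [Matrix.l2_opNorm_diagonal]
    exact (pi_norm_le_iff_of_nonneg hδ).2 hD
  have h1 : ‖Matrix.diagonal D * (Matrix.of fun x k => ψ k x : Matrix X (Fin n) ℂ)‖ ≤ δ :=
    ((Matrix.l2_opNorm_mul _ _).trans
      (mul_le_mul hdiag (hiso ψ hψ) (norm_nonneg _) hδ)).trans (mul_one δ).le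
  exact (mul_le_mul (hiso φ hφ) h1 (norm_nonneg _) zero_le_one).trans (one_mul δ).le

theorem norm_toEuclideanCLM_le_of_entries {n : ℕ} (A : Matrix (Fin n) (Fin n) ℂ) {δ : ℝ}
    (hδ : 0 ≤ δ) (hA : ∀ k l, ‖A k l‖ ≤ δ) :
    ‖Matrix.toEuclideanCLM (n := Fin n) (𝕜 := ℂ) A‖ ≤ n * δ := by
  refine ContinuousLinearMap.opNorm_le_bound _ (by positivity) fun v => ?_
  rw [EuclideanSpace.norm_eq, EuclideanSpace.norm_eq v]
  refine Real.sqrt_le_iff.2 ⟨by positivity, ?_⟩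
  rw [mul_pow, Real.sq_sqrt (by positivity)]
  have hrow : ∀ k, ‖(Matrix.toEuclideanCLM (n := Fin n) (𝕜 := ℂ) A v) k‖ ^ 2 ≤
      n * δ ^ 2 * ∑ i, ‖v i‖ ^ 2 := by
    intro k
    have h1 : ‖(Matrix.toEuclideanCLM (n := Fin n) (𝕜 := ℂ) A v) k‖ ≤ δ * ∑ i, ‖v i‖ := by
      rw [Matrix.ofLp_toEuclideanCLM, Matrix.mulVec, dotProduct, Finset.mul_sum]
      refine (norm_sum_le _ _).trans (Finset.sum_le_sum fun i _ => ?_)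
      rw [norm_mul]
      exact mul_le_mul_of_nonneg_right (hA k i) (norm_nonneg _)
    have h2 := sq_sum_le_card_mul_sum_sq (s := (Finset.univ : Finset (Fin n))) (f := fun i => ‖v i‖)
    rw [Finset.card_univ, Fintype.card_fin] at h2
    calc _ ≤ (δ * ∑ i, ‖v i‖) ^ 2 := pow_le_pow_left₀ (norm_nonneg _) h1 2
      _ = δ ^ 2 * (∑ i, ‖v i‖) ^ 2 := mul_pow _ _ _
      _ ≤ δ ^ 2 * (n * ∑ i, ‖v i‖ ^ 2) := mul_le_mul_of_nonneg_left h2 (sq_nonneg δ)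
      _ = _ := by ring
  refine (Finset.sum_le_sum fun k _ => hrow k).trans_eq ?_
  rw [Finset.sum_const, Finset.card_univ, Fintype.card_fin, nsmul_eq_mul]
  ring

theorem lowerShift_pow_apply {n : ℕ} (j : ℕ) (k l : Fin n) :
    (lowerShift n ^ j) k l = if (k : ℕ) = l + j then 1 else 0 := by
  induction j generalizing k with
  | zero => simp [Matrix.one_apply, Fin.ext_iff]
  | succ j ih =>
    rw [pow_succ', Matrix.mul_apply]
    simp only [ih]
    simp only [lowerShift, Matrix.of_apply]
    by_cases hk : (k : ℕ) = l + (j + 1)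
    · rw [if_pos hk, Finset.sum_eq_single (⟨l + j, by omega⟩ : Fin n)]
      · simp [hk, add_assoc]
      · intro i _ hi
        rw [if_neg fun h => hi (Fin.ext (by simp; omega)), zero_mul]
      · simp
    · rw [if_neg hk]
      refine Finset.sum_eq_zero fun i _ => ?_
      split_ifs <;> simp
      omega

theorem fourierToeplitz_apply {n : ℕ} (g : ℝ → ℂ) (k l : Fin n) :
    fourierToeplitz n g k l = if l ≤ k then fourierCoefficient g ((k - l : ℕ) : ℤ) else 0 := by
  simp only [fourierToeplitz, Matrix.sum_apply, Matrix.smul_apply, lowerShift_pow_apply,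
    smul_eq_mul, mul_ite, mul_one, mul_zero]
  split_ifs with h
  · rw [Finset.sum_eq_single (k - l : ℕ)]
    · rw [if_pos]
      have : (l : ℕ) ≤ k := h
      omega
    · intro j _ hj
      rw [if_neg]
      omega
    · intro h'
      exact absurd (Finset.mem_range.2 (by omega)) h'
  · refine Finset.sum_eq_zero fun j _ => if_neg ?_
    have : ¬(l : ℕ) ≤ k := h
    omega

end Norms

/-! ### Riemann sums for Fourier coefficients -/

section Quadrature

/-- By the mean value inequality the integrand `g(x) e^{ijx}` has Lipschitz constant `M' + jM`, and
each node is an endpoint of an interval of length `2π/N`. -/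
theorem norm_fourierCoefficient_sub_le {g : ℝ → ℂ} {M M' : ℝ} (hg : Differentiable ℝ g)
    (hM : ∀ x ∈ Set.Icc (-Real.pi) Real.pi, ‖g x‖ ≤ M)
    (hM' : ∀ x ∈ Set.Icc (-Real.pi) Real.pi, ‖deriv g x‖ ≤ M') {N : ℕ} (hN : 0 < N) (j : ℕ) :
    ‖1 / (N : ℂ) * ∑ s ∈ Finset.range N, g (Real.pi - 2 * Real.pi / N * s) *
        Complex.exp (Complex.I * j * (Real.pi - 2 * Real.pi / N * s : ℝ)) -
      fourierCoefficient g j‖ ≤ (M' + j * M) * (2 * Real.pi / N) := by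
  have hN' : (0 : ℝ) < N := Nat.cast_pos.2 hN
  have hpi := Real.pi_pos
  let h : ℝ → ℂ := fun x => g x * Complex.exp (Complex.I * j * x)
  let a : ℕ → ℝ := fun s => Real.pi - 2 * Real.pi / N * s
  have hE : ∀ x : ℝ, HasDerivAt (fun x : ℝ => Complex.exp (Complex.I * j * x))
      (Complex.exp (Complex.I * j * x) * (Complex.I * j)) x := by
    intro x
    have h1 : HasDerivAt (fun z : ℂ => Complex.I * j * z) (Complex.I * j) (x : ℂ) := by
      simpa using (hasDerivAt_id (x : ℂ)).const_mul (Complex.I * j)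
    exact (h1.cexp).comp_ofReal
  have hnorm : ∀ x : ℝ, ‖Complex.exp (Complex.I * j * x)‖ = 1 := by
    intro x
    rw [show (Complex.I * j * x : ℂ) = ((j * x : ℝ) : ℂ) * Complex.I by push_cast; ring,
      Complex.norm_exp_ofReal_mul_I]
  have hd : ∀ x : ℝ, HasDerivAt h (deriv g x * Complex.exp (Complex.I * j * x) +
      g x * (Complex.exp (Complex.I * j * x) * (Complex.I * j))) x := fun x =>
    (hg x).hasDerivAt.mul (hE x)
  have hlip : ∀ x ∈ Set.Icc (-Real.pi) Real.pi, ∀ y ∈ Set.Icc (-Real.pi) Real.pi,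
      ‖h y - h x‖ ≤ (M' + j * M) * ‖y - x‖ := by
    intro x hx y hy
    refine (convex_Icc (-Real.pi) Real.pi).norm_image_sub_le_of_norm_deriv_le
      (fun z _ => (hd z).differentiableAt) (fun z hz => ?_) hx hy
    rw [(hd z).deriv]
    refine (norm_add_le _ _).trans (add_le_add ?_ ?_)
    · rw [norm_mul, hnorm, mul_one]
      exact hM' z hz
    · rw [norm_mul, norm_mul, hnorm, norm_mul, Complex.norm_I, Complex.norm_natCast, one_mul,
        one_mul, mul_comm]
      exact mul_le_mul_of_nonneg_left (hM z hz) (Nat.cast_nonneg j)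
  have hK : 0 ≤ M' + j * M := by
    have h0 : (0 : ℝ) ∈ Set.Icc (-Real.pi) Real.pi := ⟨by linarith, hpi.le⟩
    exact add_nonneg ((norm_nonneg _).trans (hM' 0 h0))
      (mul_nonneg (Nat.cast_nonneg j) ((norm_nonneg _).trans (hM 0 h0)))
  have hcont : Continuous h := continuous_iff_continuousAt.2 fun x => (hd x).continuousAt
  have hstep : ∀ s, a (s + 1) - a s = -(2 * Real.pi / N) := by
    intro s
    simp only [a]
    push_cast
    ring
  have ha : ∀ s ≤ N, a s ∈ Set.Icc (-Real.pi) Real.pi := by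
    intro s hs
    have h1 : (s : ℝ) ≤ N := Nat.cast_le.2 hs
    have h2 : 2 * Real.pi / N * s ≤ 2 * Real.pi := by
      rw [div_mul_eq_mul_div, div_le_iff₀ hN']
      exact mul_le_mul_of_nonneg_left h1 (by positivity)
    have h3 : 0 ≤ 2 * Real.pi / N * s := by positivity
    exact ⟨by simp only [a]; linarith, by simp only [a]; linarith⟩
  have hsum : ∑ s ∈ Finset.range N, ∫ x in a s..a (s + 1), h x =
      -∫ x in (-Real.pi)..Real.pi, h x := by
    rw [intervalIntegral.sum_integral_adjacent_intervals
      fun s _ => hcont.intervalIntegrable _ _, ← intervalIntegral.integral_symm]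
    have h0 : a 0 = Real.pi := by simp [a]
    have h1 : a N = -Real.pi := by
      simp only [a]
      field_simp
      ring
    rw [h0, h1]
  -- The nodes decrease, so the oriented integral is near minus the Riemann term; hence the plus
  -- sign.
  have hpiece : ∀ s ∈ Finset.range N,
      ‖(∫ x in a s..a (s + 1), h x) + (2 * Real.pi / N : ℝ) * h (a s)‖ ≤
      (M' + j * M) * (2 * Real.pi / N) * (2 * Real.pi / N) := by
    intro s hs
    have hs := Finset.mem_range.1 hs
    have hc : (∫ x in a s..a (s + 1), h x) + (2 * Real.pi / N : ℝ) * h (a s) =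
        ∫ x in a s..a (s + 1), (h x - h (a s)) := by
      rw [intervalIntegral.integral_sub (hcont.intervalIntegrable _ _)
        intervalIntegrable_const, intervalIntegral.integral_const, hstep,
        Complex.real_smul]
      push_cast
      ring
    rw [hc]
    have hb := intervalIntegral.norm_integral_le_of_norm_le_const (a := a s) (b := a (s + 1))
      (f := fun x => h x - h (a s)) (C := (M' + j * M) * (2 * Real.pi / N)) (by
        intro x hx
        have hx' := Set.uIoc_subset_uIcc hx
        have hx1 : x ∈ Set.Icc (-Real.pi) Real.pi :=
          (Set.ordConnected_Icc.uIcc_subset (ha s hs.le) (ha (s + 1) hs)) hx'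
        refine (hlip _ (ha s hs.le) _ hx1).trans (mul_le_mul_of_nonneg_left ?_ hK)
        have hlen : |a (s + 1) - a s| = 2 * Real.pi / N := by
          rw [hstep, abs_neg, abs_of_pos (by positivity)]
        exact (Set.abs_sub_left_of_mem_uIcc hx').trans_eq hlen)
    rwa [hstep, abs_neg, abs_of_pos (by positivity)] at hb
  have htot := (norm_sum_le _ _).trans (Finset.sum_le_sum hpiece)
  rw [Finset.sum_add_distrib, hsum, ← Finset.mul_sum, Finset.sum_const, Finset.card_range,
    nsmul_eq_mul] at htot
  have hfinal : 1 / (N : ℂ) * ∑ s ∈ Finset.range N, g (Real.pi - 2 * Real.pi / N * s) *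
        Complex.exp (Complex.I * j * (Real.pi - 2 * Real.pi / N * s : ℝ)) -
      fourierCoefficient g j = (1 / (2 * Real.pi) : ℝ) *
        (-(∫ x in (-Real.pi)..Real.pi, h x) +
          (2 * Real.pi / N : ℝ) * ∑ s ∈ Finset.range N, h (a s)) := by
    have hNc : (N : ℂ) ≠ 0 := Nat.cast_ne_zero.2 hN.ne'
    have hpc : (Real.pi : ℂ) ≠ 0 := Complex.ofReal_ne_zero.2 hpi.ne'
    simp only [fourierCoefficient, h, a, Int.cast_natCast]
    push_cast
    field_simp
    ring
  rw [hfinal, norm_mul, Complex.norm_real, Real.norm_of_nonneg (by positivity)]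
  refine (mul_le_mul_of_nonneg_left htot (by positivity)).trans_eq ?_
  field_simp

end Quadrature

/-! ### Rounding of modulus and argument -/

section Rounding

theorem arg2pi_mem (z : ℂ) : 0 ≤ arg2pi z ∧ arg2pi z < 2 * Real.pi := by
  have := toIcoMod_mem_Ico Real.two_pi_pos 0 z.arg
  rw [zero_add] at this
  exact this

theorem norm_mul_exp_arg2pi (z : ℂ) : (‖z‖ : ℂ) * Complex.exp (arg2pi z * Complex.I) = z := by
  have h : arg2pi z = z.arg - toIcoDiv Real.two_pi_pos 0 z.arg • (2 * Real.pi) := by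
    rw [arg2pi, ← self_sub_toIcoDiv_zsmul]
  conv_rhs => rw [← Complex.norm_mul_exp_arg_mul_I z]
  congr 1
  rw [Complex.exp_eq_exp_iff_exists_int]
  refine ⟨-toIcoDiv Real.two_pi_pos 0 z.arg, ?_⟩
  rw [h]
  push_cast
  simp
  ring

/-- The circuit divides by the register size `nAbs + 1`, not by `nAbs`. The floor and this mismatch
each cost at most `1 / (nAbs + 1)`. -/
theorem norm_rounding_le {nAbs nArg : ℕ} (hArg : 0 < nArg) {z : ℂ} {M : ℝ} (hM : 0 < M)
    (hz : ‖z‖ ≤ M) :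
    ‖((⌊nAbs * (‖z‖ / M)⌋₊ / (nAbs + 1) : ℝ) : ℂ) * Complex.exp (2 * Real.pi * Complex.I / nArg *
      ⌊nArg * (arg2pi z / (2 * Real.pi))⌋₊) - z / M‖ ≤ 2 / (nAbs + 1) + 2 * Real.pi / nArg := by
  have hpi := Real.pi_pos
  have hArg' : (0 : ℝ) < nArg := Nat.cast_pos.2 hArg
  obtain ⟨hθ, hθ'⟩ := arg2pi_mem z
  set y := ‖z‖ / M with hy
  set θ := arg2pi z with hθdef
  have hy0 : 0 ≤ y := by positivity
  have hy1 : y ≤ 1 := (div_le_one hM).2 hz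
  have hv := Nat.floor_le (mul_nonneg (Nat.cast_nonneg nAbs : (0 : ℝ) ≤ nAbs) hy0)
  have hv' := Nat.lt_floor_add_one (nAbs * y)
  have hu := Nat.floor_le (by positivity : 0 ≤ nArg * (θ / (2 * Real.pi)))
  have hu' := Nat.lt_floor_add_one (nArg * (θ / (2 * Real.pi)))
  generalize ⌊nAbs * y⌋₊ = v at *
  generalize ⌊nArg * (θ / (2 * Real.pi))⌋₊ = u at *
  have hzM : z / M = (y : ℂ) * Complex.exp (Complex.I * θ) := by
    conv_lhs => rw [← norm_mul_exp_arg2pi z]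
    rw [hy, mul_comm Complex.I]
    push_cast
    ring
  have e1 : (2 * Real.pi * Complex.I / nArg * u : ℂ) =
      Complex.I * ((2 * Real.pi / nArg * u : ℝ) : ℂ) := by
    push_cast
    ring
  have hexp : ∀ a b : ℝ, ‖Complex.exp (Complex.I * a) - Complex.exp (Complex.I * b)‖ ≤ |a - b| := by
    intro a b
    have : Complex.exp (Complex.I * a) - Complex.exp (Complex.I * b) =
        Complex.exp (Complex.I * b) * (Complex.exp (Complex.I * (a - b : ℝ)) - 1) := by
      rw [mul_sub, ← Complex.exp_add, mul_one]
      congr 2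
      push_cast
      ring
    rw [this, norm_mul, mul_comm Complex.I, Complex.norm_exp_ofReal_mul_I, one_mul]
    exact Real.norm_exp_I_mul_ofReal_sub_one_le
  rw [hzM, e1]
  have hsplit : ((v / (nAbs + 1) : ℝ) : ℂ) * Complex.exp (Complex.I * (2 * Real.pi / nArg * u : ℝ)) -
      y * Complex.exp (Complex.I * θ) =
      ((v / (nAbs + 1) - y : ℝ) : ℂ) * Complex.exp (Complex.I * (2 * Real.pi / nArg * u : ℝ)) +
      y * (Complex.exp (Complex.I * (2 * Real.pi / nArg * u : ℝ)) -
        Complex.exp (Complex.I * θ)) := by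
    push_cast
    ring
  rw [hsplit]
  refine (norm_add_le _ _).trans (add_le_add ?_ ?_)
  · rw [norm_mul, mul_comm Complex.I, Complex.norm_exp_ofReal_mul_I, mul_one, Complex.norm_real,
      Real.norm_eq_abs, abs_le]
    have hpos : (0 : ℝ) < nAbs + 1 := by positivity
    constructor
    · rw [← sub_nonneg]
      have : (v : ℝ) / (nAbs + 1) - y - -(2 / (nAbs + 1)) = (v - nAbs * y + (2 - y)) / (nAbs + 1) := by
        field_simp
        ring
      rw [this]
      exact div_nonneg (by linarith) hpos.le
    · have h1 : (v : ℝ) / (nAbs + 1) ≤ y := by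
        rw [div_le_iff₀ hpos]
        nlinarith
      have : (0 : ℝ) ≤ 2 / (nAbs + 1) := by positivity
      linarith
  · rw [norm_mul, Complex.norm_real, Real.norm_of_nonneg hy0]
    refine (mul_le_mul hy1 (hexp _ _) (norm_nonneg _) zero_le_one).trans ?_
    rw [one_mul, abs_le]
    have e2 : 2 * Real.pi / nArg * u - θ = 2 * Real.pi / nArg * (u - nArg * (θ / (2 * Real.pi))) := by
      field_simp
    rw [e2]
    have hc : 0 ≤ 2 * Real.pi / nArg := by positivity
    constructor
    · nlinarith
    · nlinarith

end Rounding

theorem width_two_pow (r : ℕ) : width (2 ^ r) = r := Nat.clog_pow 2 r (by norm_num)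

theorem le_two_pow_width (n : ℕ) : n ≤ 2 ^ width n := Nat.le_pow_clog (by norm_num) n

theorem encode_injective_of_lt {w k l : ℕ} (hk : k < 2 ^ w) (hl : l < 2 ^ w)
    (h : encode w k = encode w l) : k = l := by
  have h1 : Nat.ofBits (fun i : Fin w => k.testBit i) = Nat.ofBits fun i : Fin w => l.testBit i :=
    congrArg Nat.ofBits h
  rwa [Nat.ofBits_testBit, Nat.ofBits_testBit, Nat.mod_eq_of_lt hk, Nat.mod_eq_of_lt hl] at h1

theorem ancillaZero_isometry (n a : ℕ) : (ancillaZero n a)ᴴ * ancillaZero n a = 1 := by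
  ext k l
  have hlt : ∀ k : Fin n, (k : ℕ) < 2 ^ width n := fun k => k.2.trans_le (le_two_pow_width n)
  simp only [Matrix.mul_apply, Matrix.conjTranspose_apply, ancillaZero, Matrix.of_apply]
  rw [Finset.sum_eq_single (Fin.append (encode (width n) k) fun _ : Fin a => false)]
  · rw [if_pos rfl, star_one, one_mul, Matrix.one_apply]
    refine if_congr ⟨fun h => ?_, fun h => by rw [h]⟩ rfl rfl
    refine Fin.ext (encode_injective_of_lt (hlt k) (hlt l) (funext fun i => ?_))
    simpa using congrFun h (Fin.castAdd a i)
  · intro x _ hx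
    rw [if_neg hx, star_zero, zero_mul]
  · simp

/-- For `n ≥ 2`, `(w - 1) ln 2 ≤ ln n`. At `w = 1` the claim needs only `3 ≤ π`, and each further
unit of `w` adds `1/2` on the left against `ln 2` on the right. -/
theorem width_add_two_div_two_le {n : ℕ} (hn : 1 ≤ n) :
    ((width n : ℝ) + 2) / 2 ≤ Real.pi / 2 + Real.log n := by
  have hpi := Real.pi_gt_d2
  rcases hn.eq_or_lt with rfl | hn
  · simp [width]
    linarith
  · have h1 : 2 ^ (width n - 1) < n := Nat.pow_pred_clog_lt_self (by norm_num) hn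
    have h2 : 0 < width n := Nat.clog_pos (by norm_num) hn
    have h3 : ((width n - 1 : ℕ) : ℝ) * Real.log 2 ≤ Real.log n := by
      rw [← Real.log_pow]
      exact Real.log_le_log (by positivity) (by exact_mod_cast h1.le)
    rw [Nat.cast_pred h2] at h3
    have h4 := Real.log_two_gt_d9
    have h5 : (1 : ℝ) ≤ width n := Nat.one_le_cast.2 h2
    nlinarith

theorem exists_two_pow_mem {y : ℝ} (hy : 1 ≤ y) : ∃ t : ℕ, y ≤ 2 ^ t ∧ (2 : ℝ) ^ t ≤ 2 * y := by
  obtain ⟨t, h1, h2⟩ := exists_nat_pow_near hy one_lt_two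
  exact ⟨t + 1, h2.le, by rw [pow_succ, mul_comm]; linarith⟩

/-! ### The block encoding with its error bound -/

section Encoding

variable {n nIn nAbs nArg : ℕ}

/-- The cosine and sine of the rotation that scales the encoded operator to the denominator
`π / 2 + ln n`. -/
noncomputable def scaleAmp (n : ℕ) (b : Bool) : ℝ :=
  if b then Real.sqrt (1 - (((width n : ℝ) + 2) / 2 / (Real.pi / 2 + Real.log n)) ^ 2)
  else ((width n : ℝ) + 2) / 2 / (Real.pi / 2 + Real.log n)

theorem scaleAmp_sq_add_sq (hn : 1 ≤ n) : scaleAmp n false ^ 2 + scaleAmp n true ^ 2 = 1 := by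
  have h := width_add_two_div_two_le hn
  have h0 : 0 < ((width n : ℝ) + 2) / 2 := by positivity
  have h1 : ((width n : ℝ) + 2) / 2 / (Real.pi / 2 + Real.log n) ≤ 1 :=
    (div_le_one (h0.trans_le h)).2 h
  have h2 : 0 ≤ ((width n : ℝ) + 2) / 2 / (Real.pi / 2 + Real.log n) :=
    div_nonneg h0.le (h0.le.trans h)
  simp only [scaleAmp, Bool.false_eq_true, if_false, if_true]
  rw [Real.sq_sqrt (sub_nonneg.2 (pow_le_one₀ h2 h1))]
  ring

theorem scaleAmp_false_mul : scaleAmp n false * (2 / ((width n : ℝ) + 2)) =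
    1 / (Real.pi / 2 + Real.log n) := by
  have : (width n : ℝ) + 2 ≠ 0 := by positivity
  simp only [scaleAmp, Bool.false_eq_true, if_false]
  field_simp

theorem samplePoint_zero_mem {s : ℕ} (hs : s < nIn) :
    samplePoint n nIn 0 s ∈ Set.Icc (-Real.pi) Real.pi := by
  have hpi := Real.pi_pos
  have hN : (0 : ℝ) < nIn := Nat.cast_pos.2 (by omega)
  have h2 : 2 * Real.pi / nIn * s ≤ 2 * Real.pi := by
    rw [div_mul_eq_mul_div, div_le_iff₀ hN]
    exact mul_le_mul_of_nonneg_left (Nat.cast_le.2 hs.le) (by positivity)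
  have h3 : 0 ≤ 2 * Real.pi / nIn * s := by positivity
  simp only [samplePoint, Nat.cast_zero, zero_mul, zero_div, zero_add]
  exact ⟨by linarith, by linarith⟩

/-- The block of the ideal samples `g / M`. -/
noncomputable def idealBlock (n nIn : ℕ) (g : ℝ → ℂ) (M : ℝ) : Matrix (Fin n) (Fin n) ℂ :=
  Matrix.of fun k l =>
    ∑ x, star (indexState (width nIn) (width n) (-1) (scaleAmp n) (leftSign (width n) k) k x) *
      (g (samplePoint n nIn 0 (sampleIndex x)) / M *
        indexState (width nIn) (width n) 1 (fun b => if b then 0 else 1)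
          (fun _ h => rightSign (width n) l h) l x)

/-- Entries above the diagonal vanish exactly on both sides; the others differ only by the
quadrature error. -/
theorem norm_idealBlock_sub_le (hn : 1 ≤ n) (hIn : nIn = 2 ^ width nIn)
    (hw : width n ≤ width nIn) {g : ℝ → ℂ} {M M' : ℝ} (hM0 : 0 < M) (hM'0 : 0 ≤ M')
    (hg : Differentiable ℝ g) (hM : ∀ x ∈ Set.Icc (-Real.pi) Real.pi, ‖g x‖ ≤ M)
    (hM' : ∀ x ∈ Set.Icc (-Real.pi) Real.pi, ‖deriv g x‖ ≤ M') :
    ‖Matrix.toEuclideanCLM (n := Fin n) (𝕜 := ℂ) (idealBlock n nIn g M -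
      (1 / ((Real.pi / 2 + Real.log n) * M) : ℂ) • fourierToeplitz n g)‖ ≤
      n * ((M' + n * M) * (2 * Real.pi / nIn) / M) := by
  have hpi := Real.pi_pos
  have hΛ : 1 ≤ Real.pi / 2 + Real.log n := by
    have := width_add_two_div_two_le hn
    have : (0 : ℝ) ≤ width n := Nat.cast_nonneg _
    linarith
  have hN : 0 < nIn := by rw [hIn]; positivity
  refine norm_toEuclideanCLM_le_of_entries _ (by positivity) fun k l => ?_
  have hlt : ∀ k : Fin n, (k : ℕ) < 2 ^ width n := fun k => k.2.trans_le (le_two_pow_width n)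
  have hr : (2 : ℝ) ^ width nIn = nIn := by exact_mod_cast hIn.symm
  have hc : (2 : ℂ) ^ width nIn = nIn := by exact_mod_cast hIn.symm
  rw [Matrix.sub_apply, Matrix.smul_apply, fourierToeplitz_apply, idealBlock, Matrix.of_apply,
    sum_indexState hw (hlt k) (hlt l) _ fun s => g (samplePoint n nIn 0 s) / M]
  by_cases h : l ≤ k
  · have h' : (l : ℕ) ≤ k := h
    have hj : (((k - l : ℕ) : ℕ) : ℝ) ≤ n := by
      have := k.2
      exact_mod_cast (by omega : (k - l : ℕ) ≤ n)
    rw [if_pos h', if_pos h, scaleAmp_false_mul, ← hIn, hc, hr]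
    have hsplit : ((1 / (Real.pi / 2 + Real.log n) : ℝ) : ℂ) * (1 / nIn *
        ∑ s ∈ Finset.range nIn, g (samplePoint n nIn 0 s) / M *
          Complex.exp (Complex.I * (k - l) * (Real.pi - 2 * Real.pi / nIn * s : ℝ))) -
        (1 / ((Real.pi / 2 + Real.log n) * M) : ℂ) •
          fourierCoefficient g ((k - l : ℕ) : ℤ) =
        ((1 / (Real.pi / 2 + Real.log n) / M : ℝ) : ℂ) *
          (1 / (nIn : ℂ) * ∑ s ∈ Finset.range nIn, g (Real.pi - 2 * Real.pi / nIn * s) *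
            Complex.exp (Complex.I * (k - l : ℕ) * (Real.pi - 2 * Real.pi / nIn * s : ℝ)) -
          fourierCoefficient g (k - l : ℕ)) := by
      have hS : ∑ s ∈ Finset.range nIn, g (samplePoint n nIn 0 s) / M *
          Complex.exp (Complex.I * (k - l) * (Real.pi - 2 * Real.pi / nIn * s : ℝ)) =
          (∑ s ∈ Finset.range nIn, g (Real.pi - 2 * Real.pi / nIn * s) *
            Complex.exp (Complex.I * (k - l : ℕ) * (Real.pi - 2 * Real.pi / nIn * s : ℝ))) / M := by
        rw [Finset.sum_div]
        refine Finset.sum_congr rfl fun s _ => ?_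
        rw [Nat.cast_sub h', samplePoint, Nat.cast_zero, zero_mul, zero_div, zero_add,
          div_mul_eq_mul_div]
      rw [hS, smul_eq_mul]
      generalize ∑ s ∈ Finset.range nIn, g (Real.pi - 2 * Real.pi / nIn * s) *
        Complex.exp (Complex.I * (k - l : ℕ) * (Real.pi - 2 * Real.pi / nIn * s : ℝ)) = S
      generalize Real.log n = L
      push_cast
      simp only [one_div, mul_inv]
      ring
    rw [hsplit, norm_mul, Complex.norm_real, Real.norm_of_nonneg (by positivity)]
    refine (mul_le_mul_of_nonneg_left
      (norm_fourierCoefficient_sub_le hg hM hM' hN (k - l)) (by positivity)).trans ?_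
    rw [div_mul_eq_mul_div]
    refine div_le_div_of_nonneg_right ?_ hM0.le
    have h1 : 1 / (Real.pi / 2 + Real.log n) ≤ 1 := (div_le_one (by linarith)).2 hΛ
    refine (mul_le_of_le_one_left (by positivity) h1).trans ?_
    gcongr
  · have h' : ¬ (l : ℕ) ≤ k := h
    rw [if_neg h', if_neg h]
    simp only [mul_zero, Complex.ofReal_zero, zero_mul, smul_zero, sub_zero, norm_zero]
    positivity

theorem exists_isBlockEncoding (hn : 1 ≤ n) (hIn : nIn = 2 ^ width nIn)
    (hAbs : nAbs + 1 = 2 ^ width (nAbs + 1)) (hArg : nArg = 2 ^ width nArg)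
    (hw : width n ≤ width nIn) :
    ∃ (a : ℕ) (c : Circuit (oracleWidth n nIn (nAbs + 1)) (oracleWidth n nIn nArg)
        (width n + a)), c.absQueries ≤ 2 ∧ c.argQueries ≤ 2 ∧
      c.twoQubitGates ≤ 2 * width nIn * width nIn + 10 * width nIn + 4 * width (nAbs + 1) +
        width nArg + 7 ∧
      ∀ (g : ℝ → ℂ) (M M' : ℝ), 0 < M → Differentiable ℝ g → IsMaxNorm g M →
        IsMaxNorm (deriv g) M' →
        ∀ (OAbs : QUnitary (Fin (oracleWidth n nIn (nAbs + 1))))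
          (OArg : QUnitary (Fin (oracleWidth n nIn nArg))),
          IsAbsOracle g M n nIn nAbs OAbs → IsArgOracle g n nIn nArg OArg →
          IsBlockEncoding (ancillaZero n a) (ancillaZero n a) (c.toMatrix OAbs OArg)
            ((1 / ((Real.pi / 2 + Real.log n) * M) : ℂ) • fourierToeplitz n g)
            (2 / (nAbs + 1) + 2 * Real.pi / nArg +
              n * ((M' + n * M) * (2 * Real.pi / nIn) / M)) := by
  have hpi := Real.pi_pos
  obtain ⟨a, c, hA, hB, hG, hc⟩ := exists_circuit (nIn := nIn) (dA := nAbs + 1) (dB := nArg) hn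
    hIn hw (scaleAmp_sq_add_sq hn)
  refine ⟨a, c, hA, hB, hG, ?_⟩
  intro g M M' hM0 hg hM hM' OA OB hOA hOB
  have hM1 : ∀ x ∈ Set.Icc (-Real.pi) Real.pi, ‖g x‖ ≤ M := fun x hx => hM.1 ⟨x, hx, rfl⟩
  have hM1' : ∀ x ∈ Set.Icc (-Real.pi) Real.pi, ‖deriv g x‖ ≤ M' := fun x hx => hM'.1 ⟨x, hx, rfl⟩
  have hM'0 : 0 ≤ M' := (norm_nonneg _).trans (hM1' 0 ⟨by linarith, hpi.le⟩)
  have hArg0 : 0 < nArg := by rw [hArg]; positivity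
  have hargr : (2 : ℂ) ^ width nArg = nArg := by exact_mod_cast hArg.symm
  have habsr : (2 : ℝ) ^ width (nAbs + 1) = nAbs + 1 := by exact_mod_cast hAbs.symm
  refine ⟨ancillaZero_isometry n a, ancillaZero_isometry n a,
    c.toMatrix_mem_unitaryGroup OA OB, ?_⟩
  have hfA : ∀ s < 2 ^ width nIn,
      ⌊nAbs * (‖g (samplePoint n nIn 0 s)‖ / M)⌋₊ < 2 ^ width (nAbs + 1) := by
    intro s hs
    rw [← hIn] at hs
    rw [← hAbs, Nat.lt_succ_iff]
    refine Nat.floor_le_of_le ?_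
    exact mul_le_of_le_one_right (Nat.cast_nonneg _)
      ((div_le_one hM0).2 (hM1 _ (samplePoint_zero_mem hs)))
  have hfB : ∀ s < 2 ^ width nIn,
      ⌊nArg * (arg2pi (g (samplePoint n nIn 0 s)) / (2 * Real.pi))⌋₊ < 2 ^ width nArg := by
    intro s hs
    obtain ⟨h0, h1⟩ := arg2pi_mem (g (samplePoint n nIn 0 s))
    rw [← hArg, Nat.floor_lt (by positivity)]
    exact mul_lt_of_lt_one_right (Nat.cast_pos.2 hArg0) ((div_lt_one Real.two_pi_pos).2 h1)
  have hblock := hc OA OB _ _ hOA hOB hfA hfB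
  let F : ℕ → ℂ := fun s =>
    ((⌊nAbs * (‖g (samplePoint n nIn 0 s)‖ / M)⌋₊ / (nAbs + 1) : ℝ) : ℂ) *
      Complex.exp (2 * Real.pi * Complex.I / nArg *
        ⌊nArg * (arg2pi (g (samplePoint n nIn 0 s)) / (2 * Real.pi))⌋₊)
  -- Rounding error plus quadrature error, to be bounded by the isometry argument and entrywise,
  -- respectively.
  have hsplit : (ancillaZero n a)ᴴ * c.toMatrix OA OB * ancillaZero n a -
      (1 / ((Real.pi / 2 + Real.log n) * M) : ℂ) • fourierToeplitz n g =
      (Matrix.of fun k l =>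
        ∑ x, star (indexState (width nIn) (width n) (-1) (scaleAmp n)
            (leftSign (width n) (k : Fin n)) k x) *
          ((F (sampleIndex x) - g (samplePoint n nIn 0 (sampleIndex x)) / M) *
            indexState (width nIn) (width n) 1 (fun b => if b then 0 else 1)
              (fun _ h => rightSign (width n) (l : Fin n) h) l x)) +
      (idealBlock n nIn g M -
        (1 / ((Real.pi / 2 + Real.log n) * M) : ℂ) • fourierToeplitz n g) := by
    rw [← add_sub_assoc]
    congr 1
    ext k l
    rw [hblock, Matrix.add_apply, idealBlock, Matrix.of_apply, Matrix.of_apply,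
      ← Finset.sum_add_distrib]
    refine Finset.sum_congr rfl fun x _ => ?_
    rw [habsr, hargr]
    ring
  have hlt : ∀ k : Fin n, (k : ℕ) < 2 ^ width nIn := fun k =>
    k.2.trans_le ((le_two_pow_width n).trans (Nat.pow_le_pow_right (by norm_num) hw))
  rw [hsplit, map_add]
  refine (norm_add_le _ _).trans (add_le_add ?_
    (norm_idealBlock_sub_le hn hIn hw hM0 hM'0 hg hM1 hM1'))
  refine norm_toEuclideanCLM_le_of_orthonormal
    (φ := fun (k : Fin n) x => indexState (width nIn) (width n) (-1) (scaleAmp n)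
      (leftSign (width n) k) k x)
    (ψ := fun (l : Fin n) x => indexState (width nIn) (width n) 1
      (fun b => if b then 0 else 1) (fun _ h => rightSign (width n) l h) l x)
    (D := fun x => F (sampleIndex x) - g (samplePoint n nIn 0 (sampleIndex x)) / M) ?_ ?_
    (by positivity) ?_
  · intro k l
    simp only [Fin.ext_iff]
    exact indexState_orthonormal (sign := fun l => leftSign (width n) l)
      (fun k => prepares_left hw k (scaleAmp_sq_add_sq hn)) (hlt k) (hlt l)
  · intro k l
    simp only [Fin.ext_iff]
    exact indexState_orthonormal (sign := fun l _ h => rightSign (width n) l h)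
      (fun k => prepares_right hw k) (hlt k) (hlt l)
  · intro x
    exact norm_rounding_le hArg0 hM0
      (hM1 _ (samplePoint_zero_mem ((sampleIndex_lt x).trans_eq hIn.symm)))

end Encoding

end FourierGen

/-! ### Choice of the parameters -/

theorem mainTheorem6 :
    ∃ (C : ℝ) (k Q : ℕ), 0 < C ∧
      ∀ (n : ℕ) (ε M M' : ℝ), 1 ≤ n → 0 < ε → ε ≤ 1 → 0 < M → 0 ≤ M' →
        ∃ nAbs nArg nIn : ℕ, 0 < nAbs ∧ 0 < nArg ∧ 0 < nIn ∧
          (nAbs : ℝ) ≤ C / ε ∧ (nArg : ℝ) ≤ C / ε ∧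
          (nIn : ℝ) ≤ C * (M' * n * Real.log (1 + n) / (M * ε) + n ^ 2 * Real.log (1 + n) / ε) ∧
          ∃ (a : ℕ) (c : FourierGen.Circuit (FourierGen.oracleWidth n nIn (nAbs + 1))
              (FourierGen.oracleWidth n nIn nArg) (FourierGen.width n + a)),
            c.absQueries ≤ Q ∧ c.argQueries ≤ Q ∧
            (c.twoQubitGates : ℝ) ≤
              C * Real.log (1 + (M' * n / (M * ε) + n ^ 2 / ε)) ^ k ∧
            ∀ g : ℝ → ℂ, Function.Periodic g (2 * Real.pi) → Differentiable ℝ g →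
              FourierGen.IsMaxNorm g M → FourierGen.IsMaxNorm (deriv g) M' →
              ∀ (OAbs : FourierGen.QUnitary (Fin (FourierGen.oracleWidth n nIn (nAbs + 1))))
                (OArg : FourierGen.QUnitary (Fin (FourierGen.oracleWidth n nIn nArg))),
                FourierGen.IsAbsOracle g M n nIn nAbs OAbs →
                FourierGen.IsArgOracle g n nIn nArg OArg →
                FourierGen.IsBlockEncoding (FourierGen.ancillaZero n a)
                  (FourierGen.ancillaZero n a) (c.toMatrix OAbs OArg)
                  ((1 / ((Real.pi / 2 + Real.log n) * M) : ℂ) •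
                    FourierGen.fourierToeplitz n g) ε := by
  open FourierGen in
  refine ⟨1000, 2, 2, by norm_num, ?_⟩
  intro n ε M M' hn hε hε1 hM hM'
  set X : ℝ := M' * n / (M * ε) + n ^ 2 / ε with hX
  have hn1 : (1 : ℝ) ≤ n := Nat.one_le_cast.2 hn
  have hpi := Real.pi_lt_d2
  have hpi0 := Real.pi_pos
  have hinv : 1 ≤ 1 / ε := by rw [le_div_iff₀ hε]; linarith
  have hXn : (n : ℝ) ^ 2 / ε ≤ X := le_add_of_nonneg_left (by positivity)
  have hXε : 1 / ε ≤ X := le_trans (by gcongr; nlinarith) hXn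
  have hX1 : 1 ≤ X := hinv.trans hXε
  have hnX : (n : ℝ) ≤ X := by
    refine le_trans ?_ hXn
    rw [le_div_iff₀ hε]
    nlinarith
  -- `20` suffices for a rounding error `(2 + 2π)/2^t ≤ ε/2`. Below, `16` suffices because the
  -- quadrature error equals `2πεX/2^r` and `4π ≤ 16`.
  obtain ⟨t, ht1, ht2⟩ := exists_two_pow_mem (y := 20 * (1 / ε)) (by linarith)
  obtain ⟨r, hr1, hr2⟩ := exists_two_pow_mem (y := 16 * X) (by linarith)
  have hlog2 := Real.log_two_gt_d9
  have hln : Real.log 2 ≤ Real.log (1 + n) := Real.log_le_log (by norm_num) (by linarith)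
  have hlX : Real.log 2 ≤ Real.log (1 + X) := Real.log_le_log (by norm_num) (by linarith)
  -- From `40X ≤ 2^6 (1 + X)` and `ln 2 ≤ ln(1 + X)` one gets `s ln 2 ≤ 7 ln(1 + X)`, and `7 / ln 2
  -- < 11`.
  have hpow : ∀ s : ℕ, (2 : ℝ) ^ s ≤ 40 * X → (s : ℝ) ≤ 11 * Real.log (1 + X) := by
    intro s hs
    have h1 : Real.log (2 ^ s) ≤ Real.log (2 ^ 6 * (1 + X)) :=
      Real.log_le_log (by positivity) (by linarith)
    rw [Real.log_pow, Real.log_mul (by positivity) (by positivity), Real.log_pow] at h1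
    push_cast at h1
    have hs0 : (0 : ℝ) ≤ s := Nat.cast_nonneg s
    nlinarith
  have ht3 := hpow t (by linarith)
  have hr3 := hpow r (by linarith)
  have htpos : 1 ≤ 2 ^ t := Nat.one_le_two_pow
  have habs : 2 ^ t - 1 + 1 = 2 ^ t := Nat.sub_add_cancel htpos
  have hcast : ((2 ^ t - 1 : ℕ) : ℝ) + 1 = 2 ^ t := by exact_mod_cast habs
  have hwn : width n ≤ r := by
    refine (Nat.clog_le_iff_le_pow (by norm_num)).2 ?_
    have : (n : ℝ) ≤ 2 ^ r := by linarith
    exact_mod_cast this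
  obtain ⟨a, c, hA, hB, hG, hc⟩ := exists_isBlockEncoding (n := n) (nIn := 2 ^ r)
    (nAbs := 2 ^ t - 1) (nArg := 2 ^ t) hn (by rw [width_two_pow])
    (by rw [habs, width_two_pow]) (by rw [width_two_pow]) (by rwa [width_two_pow])
  refine ⟨2 ^ t - 1, 2 ^ t, 2 ^ r, ?_, by positivity, by positivity, ?_, ?_, ?_, a, c, hA, hB,
    ?_, ?_⟩
  · have h1 : (0 : ℝ) < (2 ^ t - 1 : ℕ) := by linarith
    exact_mod_cast h1
  · have : 1000 / ε = 1000 * (1 / ε) := by ring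
    linarith
  · have : 1000 / ε = 1000 * (1 / ε) := by ring
    push_cast
    linarith
  · have h1 : M' * n * Real.log (1 + n) / (M * ε) + n ^ 2 * Real.log (1 + n) / ε =
        X * Real.log (1 + n) := by
      rw [hX]
      ring
    rw [h1]
    push_cast
    nlinarith
  · have hwA : width (2 ^ t - 1 + 1) = t := by rw [habs, width_two_pow]
    rw [hwA, width_two_pow, width_two_pow] at hG
    have hG' : (c.twoQubitGates : ℝ) ≤ 2 * r * r + 10 * r + 4 * t + t + 7 := by exact_mod_cast hG
    refine hG'.trans ?_
    have hr0 : (0 : ℝ) ≤ r := Nat.cast_nonneg r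
    generalize Real.log (1 + X) = y at *
    -- A lower bound on the logarithm lets its square absorb the linear and constant terms of the
    -- gate count.
    have hy : 0.69 ≤ y := by linarith
    nlinarith
  · intro g _ hg hgM hgM' OA OB hOA hOB
    obtain ⟨h1, h2, h3, h4⟩ := hc g M M' hM hg hgM hgM' OA OB hOA hOB
    refine ⟨h1, h2, h3, h4.trans ?_⟩
    push_cast
    rw [hcast]
    have ht : 2 / (2 : ℝ) ^ t + 2 * Real.pi / 2 ^ t ≤ ε / 2 := by
      rw [← add_div, div_le_iff₀ (by positivity)]
      have : 20 ≤ 2 ^ t * ε := by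
        have := mul_le_mul_of_nonneg_right ht1 hε.le
        field_simp at this
        linarith
      linarith
    have hr : n * ((M' + n * M) * (2 * Real.pi / 2 ^ r) / M) ≤ ε / 2 := by
      have e : n * ((M' + n * M) * (2 * Real.pi / 2 ^ r) / M) =
          ε * (2 * Real.pi) * X / 2 ^ r := by
        rw [hX]
        field_simp
      rw [e, div_le_iff₀ (by positivity)]
      have := mul_le_mul_of_nonneg_left hr1 hε.le
      have : 0 < ε * X := by positivity
      nlinarith
    linarith
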